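/- Let $N,m\ge 0$ with $N+2m\geq 1$, and let $V=V_{\bar 0}\oplus V_{\bar 1}$ be a complex superspace with $\dim V_{\bar 0}=N$, $\dim V_{\bar 1}=2m$ and a homogeneous basis $v_1,\dots,v_{N+2m}$, $v_i$ of parity $\bar i\in\mathbb Z/2$, such that $\overline{i'}=\bar i$ for all $i$, where $i'=N+2m+1-i$. Put $\kappa=\frac N2-m-1$, and $\theta_i=1$, $\theta_{i'}=(-1)^{\bar i}$ for $1\le i\le\lceil N/2\rceil+m$. Let $X=X^{\mathrm{rtt}}(\mathfrak{osp}(V))$ be the associative $\mathbb C$-superalgebra generated by $t_{ij}^{(r)}$ ($1\le i,j\le N+2m$, $r\ge1$), of parity $\bar i+\bar j$, with the defining relations, for $t_{ij}(u)=\delta_{ij}+\sum_{r\ge1}t_{ij}^{(r)}u^{-r}$ and all $i,j,k,\ell$ (with $[\cdot,\cdot]$ the supercommutator), $$[t_{ij}(u),t_{k\ell}(v)]=\frac{(-1)^{\bar i\bar j+\bar i\bar k+\bar j\bar k}}{u-v}\bigl(t_{kj}(u)t_{i\ell}(v)-t_{kj}(v)t_{i\ell}(u)\bigr)-\frac1{u-v-\kappa}\Bigl(\delta_{ki'}\sum_{p}(-1)^{\bar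 i+\bar i\bar j+\bar j\bar p}\theta_i\theta_p\,t_{pj}(u)t_{p'\ell}(v)-\delta_{\ell j'}\sum_{p}(-1)^{\bar i\bar k+\bar j\bar k+\bar i\bar p}\theta_{j'}\theta_{p'}\,t_{kp'}(v)t_{ip}(u)\Bigr).$$ (This is the RTT relation $R(u-v)T_1(u)T_2(v)=T_2(v)T_1(u)R(u-v)$ for $R(u)=\mathrm I-\frac Pu+\frac Q{u-\kappa}$, written entrywise.) Let $T(u)=(t_{ij}(u))$, let $T^t(u)_{ij}=(-1)^{\bar i\bar j+\bar j}\theta_i\theta_j\,t_{j'i'}(u)$, and let $h_1(u),\dots,h_{N+2m}(u)\in X[[u^{-1}]]$ be the diagonal entries of $H(u)$ in the Gauss decomposition $T(u)=F(u)H(u)E(u)$, with $F(u)$ lower unitriangular, $H(u)$ diagonal and $E(u)$ upper unitriangular. Then there is a (unique) series $c_V(u)=1+\sum_{r\ge1}c_ru^{-r}$ with all $c_r$ in the center of $X$ and $T(u-\kappa)T^t(u)=c_V(u)\cdot\mathrm{Id}$. All coefficients of the series $h_\imath(u)$, $1\le\imath\le\lfloor N/2\rfloor+m+1$, commute with each other.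 Moreover: (a) If $N=2n$ and $v_{n+m}$ is even, then $$c_V(u)=\prod_{i=1}^{n+m-1}\frac{h_i\bigl(u-\sum_{k=1}^{i-1}(-1)^{\bar k}\bigr)}{h_i\bigl(u-\sum_{k=1}^{i}(-1)^{\bar k}\bigr)}\cdot h_{n+m}(u-n+m+1)\,h_{n+m+1}(u-n+m+1).$$ (b) If $N=2n$ and $v_{n+m}$ is odd, then $$c_V(u)=\prod_{i=1}^{n+m-1}\frac{h_i\bigl(u-\sum_{k=1}^{i-1}(-1)^{\bar k}\bigr)}{h_i\bigl(u-\sum_{k=1}^{i}(-1)^{\bar k}\bigr)}\cdot h_{n+m}(u-n+m-1)\,h_{n+m+1}(u-n+m+1).$$ (c) If $N=2n+1$, then $$c_V(u)=\prod_{i=1}^{n+m}\frac{h_i\bigl(u-\sum_{k=1}^{i-1}(-1)^{\bar k}\bigr)}{h_i\bigl(u-\sum_{k=1}^{i}(-1)^{\bar k}\bigr)}\cdot h_{n+m+1}\bigl(u-n+m+\tfrac12\bigr)\,h_{n+m+1}(u-n+m).$$ -/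

import Mathlib

open PowerSeries

noncomputable section

/-! ### Parity data of an orthosymplectic superspace -/

/-- The parities of a basis `v_1, …, v_{N+2m}` of a superspace `V` with `dim V_0 = N` and
`dim V_1 = 2m`, such that `v_i` and `v_{i'}` have the same parity, where `i' = N + 2m + 1 - i`.
Indices are counted from `0`: the basis vector `v_i` has index `i - 1`, so `i ↦ i'` is `Fin.rev`.
The value `par i : ZMod 2` is the parity of the vector with index `i`. -/
structure OspParity (N m : ℕ) where
  par : Fin (N + 2 * m) → ZMod 2
  par_rev : ∀ i, par i.rev = par i
  card_odd : (Finset.univ.filter fun i => par i = 1).card = 2 * m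

/-- The sign `(-1)^a` for `a ∈ ℤ/2`. -/
def paritySign (a : ZMod 2) : ℂ := if a = 0 then 1 else -1

namespace OspParity

/-- `θ_i = 1` and `θ_{i'} = (-1)^{|i|}` for `1 ≤ i ≤ ⌈N/2⌉ + m`. -/
def theta {N m : ℕ} (P : OspParity N m) (i : Fin (N + 2 * m)) : ℂ :=
  if (i : ℕ) < (N + 1) / 2 + m then 1 else paritySign (P.par i)

/-- `κ = N/2 - m - 1`. -/
def kappa {N m : ℕ} (_P : OspParity N m) : ℂ := (N : ℂ) / 2 - (m : ℂ) - 1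

/-- The partial sum `∑_{k=1}^{s} (-1)^{|k|}` over the first `s` basis vectors. -/
def signSum {N m : ℕ} (P : OspParity N m) (s : ℕ) : ℂ :=
  ∑ k : Fin (N + 2 * m), if (k : ℕ) < s then paritySign (P.par k) else 0

end OspParity

/-! ### Series in `u⁻¹` with coefficients in a possibly noncommutative algebra

A series `f(u) = ∑ f_r u^{-r}` is the power series `∑ f_r X^r`, with `X = u⁻¹`. -/

/-- `f(u + a)`, expanded in `u⁻¹` through
`(u + a)^{-r} = ∑_k (binomial of -r over k) a^k u^{-r-k}`. -/
def seriesShift {A : Type*} [Ring A] [Algebra ℂ A] (a : ℂ) (f : PowerSeries A) :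
    PowerSeries A :=
  PowerSeries.mk fun s => ∑ r ∈ Finset.range (s + 1),
    (((Ring.choose (-(r : ℤ)) (s - r) : ℤ) : ℂ) * a ^ (s - r)) • coeff r f

/-- `f(u)` as a series in the two variables `u⁻¹` (outer) and `v⁻¹` (inner). -/
def atU {A : Type*} [Ring A] (f : PowerSeries A) : PowerSeries (PowerSeries A) :=
  PowerSeries.map (C (R := A)) f

/-- `f(v)` as a series in the two variables `u⁻¹` (outer) and `v⁻¹` (inner). -/
def atV {A : Type*} [Ring A] (f : PowerSeries A) : PowerSeries (PowerSeries A) :=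
  C (R := PowerSeries A) f

/-- The variable `u⁻¹`. -/
def invU (A : Type*) [Ring A] : PowerSeries (PowerSeries A) := X

/-- The variable `v⁻¹`. -/
def invV (A : Type*) [Ring A] : PowerSeries (PowerSeries A) :=
  C (R := PowerSeries A) X

/-- `u⁻¹ v⁻¹ (u - v) = v⁻¹ - u⁻¹`. -/
def clearUV (A : Type*) [Ring A] : PowerSeries (PowerSeries A) := invV A - invU A

/-- `u⁻¹ v⁻¹ (u - v - a) = v⁻¹ - u⁻¹ - a u⁻¹ v⁻¹`. -/
def clearUVShift (A : Type*) [Ring A] [Algebra ℂ A] (a : ℂ) : PowerSeries (PowerSeries A) :=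
  invV A - invU A - a • (invU A * invV A)

/-! ### The RTT extended Yangian -/

/-- The generator `t_{ij}^{(r+1)}` is indexed by `(i, j, r)`. -/
abbrev OspFree (N m : ℕ) : Type :=
  FreeAlgebra ℂ (Fin (N + 2 * m) × Fin (N + 2 * m) × ℕ)

/-- `t_{ij}(u) = δ_{ij} + ∑_{r ≥ 1} t_{ij}^{(r)} u^{-r}` over the free algebra. -/
def freeT (N m : ℕ) (i j : Fin (N + 2 * m)) : PowerSeries (OspFree N m) :=
  PowerSeries.mk fun s => match s with
    | 0 => if i = j then 1 else 0
    | r + 1 => FreeAlgebra.ι ℂ (i, j, r)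

/-- The supercommutator `[t_{ij}(u), t_{kl}(v)]`, multiplied by
`u⁻² v⁻² (u - v) (u - v - κ)`. -/
def rttLeft {N m : ℕ} (P : OspParity N m) (i j k l : Fin (N + 2 * m)) :
    PowerSeries (PowerSeries (OspFree N m)) :=
  clearUV _ * clearUVShift _ P.kappa *
    (atU (freeT N m i j) * atV (freeT N m k l) -
      paritySign ((P.par i + P.par j) * (P.par k + P.par l)) •
        (atV (freeT N m k l) * atU (freeT N m i j)))

/-- The right-hand side of the RTT relation for `[t_{ij}(u), t_{kl}(v)]`, that is
`ε (u - v)⁻¹ (t_{kj}(u) t_{il}(v) - t_{kj}(v) t_{il}(u))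
  - (u - v - κ)⁻¹ (δ_{k i'} ∑_p … - δ_{l j'} ∑_p …)`,
multiplied by `u⁻² v⁻² (u - v) (u - v - κ)`. -/
def rttRight {N m : ℕ} (P : OspParity N m) (i j k l : Fin (N + 2 * m)) :
    PowerSeries (PowerSeries (OspFree N m)) :=
  invU _ * invV _ * clearUVShift _ P.kappa *
      (paritySign (P.par i * P.par j + P.par i * P.par k + P.par j * P.par k) •
        (atU (freeT N m k j) * atV (freeT N m i l) -
          atV (freeT N m k j) * atU (freeT N m i l))) -
    invU _ * invV _ * clearUV _ *
      ((if k = i.rev then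
          ∑ p : Fin (N + 2 * m),
            (paritySign (P.par i + P.par i * P.par j + P.par j * P.par p) *
                P.theta i * P.theta p) •
              (atU (freeT N m p j) * atV (freeT N m p.rev l))
        else 0) -
        (if l = j.rev then
          ∑ p : Fin (N + 2 * m),
            (paritySign (P.par i * P.par k + P.par j * P.par k + P.par i * P.par p) *
                P.theta j.rev * P.theta p.rev) •
              (atV (freeT N m k p.rev) * atU (freeT N m i p))
        else 0))

/-- The defining relations: all coefficients of the RTT relation, matrix entry by matrix entry.
Multiplication by `u⁻² v⁻² (u - v) (u - v - κ)` loses nothing, since `v⁻¹ - u⁻¹` and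
`v⁻¹ - u⁻¹ - κ u⁻¹ v⁻¹` are not zero divisors. -/
inductive RttRel {N m : ℕ} (P : OspParity N m) : OspFree N m → OspFree N m → Prop
  | rtt (i j k l : Fin (N + 2 * m)) (a b : ℕ) :
      RttRel P (coeff b (coeff a (rttLeft P i j k l))) (coeff b (coeff a (rttRight P i j k l)))

/-- The RTT extended Yangian of `osp(V)`, as an associative algebra over `ℂ`. -/
abbrev ExtYangian {N m : ℕ} (P : OspParity N m) : Type := RingQuot (RttRel P)

/-- The generator `t_{ij}^{(r+1)}` of the extended Yangian. -/
def tGen {N m : ℕ} (P : OspParity N m) (i j : Fin (N + 2 * m)) (r : ℕ) : ExtYangian P :=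
  RingQuot.mkAlgHom ℂ (RttRel P) (FreeAlgebra.ι ℂ (i, j, r))

/-- The generator matrix `T(u) = (t_{ij}(u))`. -/
def tMatrix {N m : ℕ} (P : OspParity N m) :
    Matrix (Fin (N + 2 * m)) (Fin (N + 2 * m)) (PowerSeries (ExtYangian P)) :=
  Matrix.of fun i j => PowerSeries.mk fun s => match s with
    | 0 => if i = j then 1 else 0
    | r + 1 => tGen P i j r

/-- The supertranspose `T^t(u)_{ij} = (-1)^{|i||j| + |j|} θ_i θ_j t_{j'i'}(u)`. -/
def tTransposed {N m : ℕ} (P : OspParity N m) :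
    Matrix (Fin (N + 2 * m)) (Fin (N + 2 * m)) (PowerSeries (ExtYangian P)) :=
  Matrix.of fun i j =>
    (paritySign (P.par i * P.par j + P.par j) * P.theta i * P.theta j) •
      tMatrix P j.rev i.rev

/-- `c(u)` is the central series: `c(u) = 1 + ∑_{r ≥ 1} c_r u^{-r}` with all `c_r` in the center
of the extended Yangian, and `T(u - κ) T^t(u) = c(u) · Id`. -/
structure IsCentralSeries {N m : ℕ} (P : OspParity N m) (c : PowerSeries (ExtYangian P)) :
    Prop where
  coeff_zero : coeff 0 c = 1
  mem_center : ∀ r, coeff r c ∈ Subalgebra.center ℂ (ExtYangian P)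
  mul_eq : (tMatrix P).map (seriesShift (-P.kappa)) * tTransposed P = Matrix.diagonal fun _ => c

/-! ### Gauss decomposition -/

/-- `T = F · diag(h) · E` with `F` lower and `E` upper unitriangular. -/
structure IsGaussDecomposition {S : Type*} [Ring S] {d : ℕ} (T : Matrix (Fin d) (Fin d) S)
    (F : Matrix (Fin d) (Fin d) S) (h : Fin d → S) (E : Matrix (Fin d) (Fin d) S) : Prop where
  lower_diag : ∀ i, F i i = 1
  lower_zero : ∀ i j, i < j → F i j = 0
  upper_diag : ∀ i, E i i = 1
  upper_zero : ∀ i j, j < i → E i j = 0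
  eq_mul : T = F * Matrix.diagonal h * E

theorem exists_gaussDecomposition {A : Type*} [Ring A] {d : ℕ}
    (T : Matrix (Fin d) (Fin d) (PowerSeries A))
    (hT : ∀ i j, constantCoeff (T i j) = if i = j then 1 else 0) :
    ∃ h F E, IsGaussDecomposition T F h E := by
  induction d with
  | zero =>
    exact ⟨fun i => i.elim0, 1, 1, fun i => i.elim0, fun i => i.elim0, fun i => i.elim0,
      fun i => i.elim0, by ext i; exact i.elim0⟩
  | succ d ih =>
    have h00 : constantCoeff (T 0 0) = ((1 : Aˣ) : A) := by simp [hT]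
    set b : PowerSeries A := invOfUnit (T 0 0) 1 with hb
    have hab : T 0 0 * b = 1 := mul_invOfUnit _ _ h00
    have hba : b * T 0 0 = 1 := invOfUnit_mul _ _ h00
    obtain ⟨h, F, E, hG⟩ := ih
      (Matrix.of fun i j : Fin d => T i.succ j.succ - T i.succ 0 * b * T 0 j.succ) (by
        intro i j
        simp [hT])
    refine ⟨Fin.cons (T 0 0) h,
      Matrix.of (Fin.cons (Fin.cons 1 0) fun i => Fin.cons (T i.succ 0 * b) (F i)),
      Matrix.of (Fin.cons (Fin.cons 1 fun j => b * T 0 j.succ) fun i => Fin.cons 0 (E i)),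
      ?_, ?_, ?_, ?_, ?_⟩
    · intro i
      cases i using Fin.cases <;> simp [hG.lower_diag]
    · intro i j hij
      cases i using Fin.cases <;> cases j using Fin.cases
      · simp at hij
      · simp
      · simp at hij
      · simpa using hG.lower_zero _ _ (Fin.succ_lt_succ_iff.mp hij)
    · intro i
      cases i using Fin.cases <;> simp [hG.upper_diag]
    · intro i j hij
      cases i using Fin.cases <;> cases j using Fin.cases
      · simp at hij
      · simp at hij
      · simp
      · simpa using hG.upper_zero _ _ (Fin.succ_lt_succ_iff.mp hij)
    · ext1 i j
      rw [Matrix.mul_apply, Fin.sum_univ_succ]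
      simp only [Matrix.mul_diagonal]
      cases i using Fin.cases with
      | zero =>
        cases j using Fin.cases with
        | zero => simp
        | succ j => simp [← mul_assoc, hab]
      | succ i =>
        cases j using Fin.cases with
        | zero => simp [mul_assoc, hba]
        | succ j =>
          have := congrFun (congrFun hG.eq_mul i) j
          rw [Matrix.mul_apply] at this
          simp only [Matrix.mul_diagonal, Matrix.of_apply] at this
          have h2 : T i.succ 0 * b * T 0 0 * (b * T 0 j.succ) = T i.succ 0 * b * T 0 j.succ := by
            rw [mul_assoc (T i.succ 0) b, hba, mul_one, mul_assoc]
          simp [← this, h2]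

/-- The first step of Gaussian elimination, read off from a decomposition `T = F · diag(h) · E`. -/
theorem IsGaussDecomposition.peel {S : Type*} [Ring S] {d : ℕ}
    {T F E : Matrix (Fin (d + 1)) (Fin (d + 1)) S} {h : Fin (d + 1) → S} {b : S}
    (hG : IsGaussDecomposition T F h E) (hab : T 0 0 * b = 1) :
    h 0 = T 0 0 ∧ (∀ i : Fin d, F i.succ 0 * h 0 = T i.succ 0) ∧
      (∀ j : Fin d, h 0 * E 0 j.succ = T 0 j.succ) ∧
      IsGaussDecomposition
        (Matrix.of fun i j : Fin d => T i.succ j.succ - T i.succ 0 * b * T 0 j.succ)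
        (Matrix.of fun i j : Fin d => F i.succ j.succ) (fun i => h i.succ)
        (Matrix.of fun i j : Fin d => E i.succ j.succ) := by
  have key : ∀ i j, T i j = F i 0 * h 0 * E 0 j +
      ∑ k : Fin d, F i k.succ * h k.succ * E k.succ j := by
    intro i j
    have := congrFun (congrFun hG.eq_mul i) j
    rw [Matrix.mul_apply, Fin.sum_univ_succ] at this
    simpa only [Matrix.mul_diagonal] using this
  have hF0 : ∀ k : Fin d, F 0 k.succ = 0 := fun k => hG.lower_zero _ _ (Fin.succ_pos k)
  have hE0 : ∀ k : Fin d, E k.succ 0 = 0 := fun k => hG.upper_zero _ _ (Fin.succ_pos k)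
  have e00 : h 0 = T 0 0 := by
    rw [key 0 0]; simp [hF0, hG.lower_diag, hG.upper_diag]
  have ei0 : ∀ i : Fin d, F i.succ 0 * h 0 = T i.succ 0 := by
    intro i; rw [key i.succ 0]; simp [hE0, hG.upper_diag]
  have e0j : ∀ j : Fin d, h 0 * E 0 j.succ = T 0 j.succ := by
    intro j; rw [key 0 j.succ]; simp [hF0, hG.lower_diag]
  refine ⟨e00, ei0, e0j, fun i => hG.lower_diag _,
    fun i j hij => hG.lower_zero _ _ (Fin.succ_lt_succ_iff.mpr hij), fun i => hG.upper_diag _,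
    fun i j hij => hG.upper_zero _ _ (Fin.succ_lt_succ_iff.mpr hij), ?_⟩
  ext1 i j
  rw [Matrix.mul_apply]
  simp only [Matrix.mul_diagonal, Matrix.of_apply]
  have h1 : T i.succ 0 * b * T 0 j.succ = F i.succ 0 * h 0 * E 0 j.succ := by
    rw [← ei0, ← e0j, mul_assoc (F i.succ 0) (h 0) b, e00, hab, mul_one, mul_assoc]
  rw [h1, key i.succ j.succ, add_sub_cancel_left]

theorem gaussDecomposition_unique {A : Type*} [Ring A] {d : ℕ}
    (T : Matrix (Fin d) (Fin d) (PowerSeries A))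
    (hT : ∀ i j, constantCoeff (T i j) = if i = j then 1 else 0)
    {F F' : Matrix (Fin d) (Fin d) (PowerSeries A)} {h h' : Fin d → PowerSeries A}
    {E E' : Matrix (Fin d) (Fin d) (PowerSeries A)}
    (hG : IsGaussDecomposition T F h E) (hG' : IsGaussDecomposition T F' h' E') :
    F = F' ∧ h = h' ∧ E = E' := by
  induction d with
  | zero =>
    exact ⟨by ext i; exact i.elim0, by ext i; exact i.elim0, by ext i; exact i.elim0⟩
  | succ d ih =>
    have h00 : constantCoeff (T 0 0) = ((1 : Aˣ) : A) := by simp [hT]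
    set b : PowerSeries A := invOfUnit (T 0 0) 1 with hb
    have hab : T 0 0 * b = 1 := mul_invOfUnit _ _ h00
    have hba : b * T 0 0 = 1 := invOfUnit_mul _ _ h00
    obtain ⟨p1, p2, p3, p4⟩ := hG.peel hab
    obtain ⟨q1, q2, q3, q4⟩ := hG'.peel hab
    have hT' : ∀ i j : Fin d, constantCoeff
        ((Matrix.of fun i j : Fin d => T i.succ j.succ - T i.succ 0 * b * T 0 j.succ) i j) =
          if i = j then 1 else 0 := by
      intro i j
      simp [hT]
    obtain ⟨r1, r2, r3⟩ := ih _ hT' p4 q4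
    refine ⟨?_, ?_, ?_⟩
    · ext1 i j
      cases j using Fin.cases with
      | zero =>
        cases i using Fin.cases with
        | zero => rw [hG.lower_diag, hG'.lower_diag]
        | succ i =>
          have := (p2 i).trans (q2 i).symm
          rw [p1, q1] at this
          have := congrArg (· * b) this
          simpa [mul_assoc, hab] using this
      | succ j =>
        cases i using Fin.cases with
        | zero => rw [hG.lower_zero _ _ (Fin.succ_pos j), hG'.lower_zero _ _ (Fin.succ_pos j)]
        | succ i => exact congrFun (congrFun r1 i) j
    · ext1 i
      cases i using Fin.cases with
      | zero => rw [p1, q1]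
      | succ i => exact congrFun r2 i
    · ext1 i j
      cases i using Fin.cases with
      | zero =>
        cases j using Fin.cases with
        | zero => rw [hG.upper_diag, hG'.upper_diag]
        | succ j =>
          have := (p3 j).trans (q3 j).symm
          rw [p1, q1] at this
          have := congrArg (b * ·) this
          simpa [← mul_assoc, hba] using this
      | succ i =>
        cases j using Fin.cases with
        | zero => rw [hG.upper_zero _ _ (Fin.succ_pos i), hG'.upper_zero _ _ (Fin.succ_pos i)]
        | succ j => exact congrFun (congrFun r3 i) j

theorem tMatrix_constantCoeff {N m : ℕ} (P : OspParity N m) (i j : Fin (N + 2 * m)) :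
    constantCoeff (tMatrix P i j) = if i = j then 1 else 0 := by
  rw [← coeff_zero_eq_constantCoeff_apply]
  simp [tMatrix]

/-- The diagonal entries `h_i(u)` of the Gauss decomposition `T(u) = F(u) H(u) E(u)`. -/
def hSeries {N m : ℕ} (P : OspParity N m) : Fin (N + 2 * m) → PowerSeries (ExtYangian P) :=
  (exists_gaussDecomposition (tMatrix P) (tMatrix_constantCoeff P)).choose

theorem hSeries_spec {N m : ℕ} (P : OspParity N m) :
    ∃ F E, IsGaussDecomposition (tMatrix P) F (hSeries P) E :=
  (exists_gaussDecomposition (tMatrix P) (tMatrix_constantCoeff P)).choose_spec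

theorem eq_hSeries {N m : ℕ} (P : OspParity N m)
    {F E : Matrix (Fin (N + 2 * m)) (Fin (N + 2 * m)) (PowerSeries (ExtYangian P))}
    {h : Fin (N + 2 * m) → PowerSeries (ExtYangian P)}
    (hG : IsGaussDecomposition (tMatrix P) F h E) : h = hSeries P := by
  obtain ⟨F', E', hG'⟩ := hSeries_spec P
  exact (gaussDecomposition_unique _ (tMatrix_constantCoeff P) hG hG').2.1

/-- The ratio `h_i(u - ∑_{k=1}^{i-1} (-1)^{|k|}) / h_i(u - ∑_{k=1}^{i} (-1)^{|k|})`.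
The denominator is invertible, as its constant term is `1`. -/
def hRatio {N m : ℕ} (P : OspParity N m) (i : Fin (N + 2 * m)) : PowerSeries (ExtYangian P) :=
  seriesShift (-P.signSum i) (hSeries P i) *
    Ring.inverse (seriesShift (-P.signSum (i + 1)) (hSeries P i))

/-- The product of the ratios for the first `s` indices, in increasing order. -/
def hRatioProd {N m : ℕ} (P : OspParity N m) (s : ℕ) (hs : s ≤ N + 2 * m) :
    PowerSeries (ExtYangian P) :=
  ((List.finRange s).map fun i => hRatio P (Fin.castLE hs i)).prod

end

/-! Scalar product. Multiplying the RTT relation by `(u - v)(u - v - κ)` and setting `v = u - κ`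
leaves only the two sums coming from `Q` (`contraction_relation`). Up to signs these sums are the
entries of `T(u - κ) T^t(u)`. Choosing the indices so that one sum is absent kills the off-diagonal
entries, and keeping both shows that all diagonal entries agree (`exists_mul_tTransposed`).

Centrality. Write `c(v) = ∑_q a_{iq} b_{qi}` with `a = T(v - κ)` and `b = T^t(v)`, and move
`t_{ij}(u)` first past `a`, then past `b`. The extra terms cancel (`commutator_of_crossing`), and
what remains is a series with regular leading term times `[t_{ij}(u), c(v)]`, equal to zero.

Two Gauss decompositions. Reversing rows and columns turns `T^t(u)` into a matrix with diagonal part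
`h'_i(u)`. Comparing triangular factors in `T(u - κ) T^t(u) = c(u)` gives `h_{i'}(u - κ) h'_i(u) =
c(u)` (`IsGaussDecomposition.mul_rev_eq`). So it suffices to express `h'_i` through the `h_k` for
`i` in the first half, up to and including the middle.

Reduction to `gl`. In the top left block of size `⌈N/2⌉ + m` the `Q`-terms disappear, except between
entries sharing the middle row or the middle column when `N` is odd (`block_isPartialRTT`). In that
block the reversed `T^t` is the plain supertranspose of `T` (`block_superTranspose`). For such
matrices Gaussian elimination proceeds by induction. Schur complements of the corner satisfy the
same relations (`exchangeRel_schurEntry`) and commute with the corner. The Schur complement of the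
supertranspose is `h_1(u) / h_1(u - ε)` times the supertransposed Schur complement at `u - ε`, with
`ε = (-1)^{|1|}` (`IsPartialRTT.superTranspose_schur`). Iterating gives the product of ratios
(`IsPartialRTT.superTranspose_diag`). The index `i = n + m` for even `N`, and the middle index for
odd `N`, yield the formulas.

Commutativity. Inside the block it follows from the Schur complement argument, except for the middle
series with itself. That series commutes with `c` and with the product of ratios, hence with a
product of two of its own shifts, and such a product determines it (`coeffsIn_of_shift_mul_shift`).
The mirror images `h_{i'}` are recovered from `c` and the block. -/

noncomputable section

section

/-! ### The shift `u ↦ u + a` as a ring homomorphism -/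

/-- The coefficient of `u^{-s}` in `(u + a)^{-r}`. -/
def shiftCoeff (a : ℂ) (r s : ℕ) : ℂ :=
  if r ≤ s then ((Ring.choose (-(r : ℤ)) (s - r) : ℤ) : ℂ) * a ^ (s - r) else 0

theorem shiftCoeff_of_lt (a : ℂ) {r s : ℕ} (h : s < r) : shiftCoeff a r s = 0 :=
  if_neg (by omega)

theorem shiftCoeff_self (a : ℂ) (r : ℕ) : shiftCoeff a r r = 1 := by
  simp [shiftCoeff]

theorem shiftCoeff_add_right (a : ℂ) (r k : ℕ) :
    shiftCoeff a r (r + k) = ((Ring.choose (-(r : ℤ)) k : ℤ) : ℂ) * a ^ k := by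
  simp [shiftCoeff]

theorem shiftCoeff_zero_left (a : ℂ) (s : ℕ) : shiftCoeff a 0 s = if s = 0 then 1 else 0 := by
  cases s with
  | zero => simp [shiftCoeff]
  | succ s => simp [shiftCoeff, Ring.choose_zero_succ]

/-- The law `(u + a)^{-i-j} = (u + a)^{-i} (u + a)^{-j}`, which is the Vandermonde identity for
binomials with negative upper entry. It makes the shift multiplicative. -/
theorem shiftCoeff_add_left (a : ℂ) (i j s : ℕ) :
    shiftCoeff a (i + j) s =
      ∑ x ∈ Finset.HasAntidiagonal.antidiagonal s, shiftCoeff a i x.1 * shiftCoeff a j x.2 := by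
  by_cases h : i + j ≤ s
  · obtain ⟨k, rfl⟩ := Nat.exists_eq_add_of_le h
    rw [shiftCoeff_add_right]
    have e : (-((i + j : ℕ) : ℤ)) = -(i : ℤ) + -(j : ℤ) := by push_cast; ring
    rw [e, Ring.add_choose_eq k (Commute.all _ _)]
    push_cast
    rw [Finset.sum_mul]
    symm
    refine Finset.sum_of_injOn (fun x => (i + x.1, j + x.2)) ?_ ?_ ?_ ?_ |>.symm
    · intro x _ y _ hxy
      simp only [Prod.mk.injEq] at hxy
      ext <;> omega
    · intro x hx
      simp only [Finset.mem_coe,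
        Finset.HasAntidiagonal.mem_antidiagonal] at hx ⊢
      omega
    · intro x hx hx'
      by_cases h1 : x.1 < i
      · rw [shiftCoeff_of_lt a h1, zero_mul]
      by_cases h2 : x.2 < j
      · rw [shiftCoeff_of_lt a h2, mul_zero]
      exfalso
      apply hx'
      rw [Finset.HasAntidiagonal.mem_antidiagonal] at hx
      refine ⟨(x.1 - i, x.2 - j), ?_, ?_⟩
      · simp only [Finset.mem_coe, Finset.HasAntidiagonal.mem_antidiagonal]; omega
      · ext <;> simp <;> omega
    · intro x hx
      rw [Finset.HasAntidiagonal.mem_antidiagonal] at hx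
      simp only [shiftCoeff_add_right]
      rw [← hx, pow_add]
      ring
  · rw [shiftCoeff_of_lt a (by omega)]
    symm
    apply Finset.sum_eq_zero
    intro x hx
    rw [Finset.HasAntidiagonal.mem_antidiagonal] at hx
    by_cases h1 : x.1 < i
    · rw [shiftCoeff_of_lt a h1, zero_mul]
    · rw [shiftCoeff_of_lt a (show x.2 < j by omega), mul_zero]

/-- Composition of shifts: after the trinomial revision of the two binomials the sum is the binomial
theorem for `(a + b)^{s-r}`. -/
theorem sum_shiftCoeff_mul (a b : ℂ) (r s : ℕ) :
    ∑ q ∈ Finset.range (s + 1), shiftCoeff a q s * shiftCoeff b r q = shiftCoeff (a + b) r s := by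
  by_cases h : r ≤ s
  · obtain ⟨k, rfl⟩ := Nat.exists_eq_add_of_le h
    rw [shiftCoeff_add_right, add_assoc, Finset.sum_range_add, Finset.sum_eq_zero, zero_add,
      add_comm a b, add_pow, Finset.mul_sum]
    · refine Finset.sum_congr rfl fun j hj => ?_
      rw [Finset.mem_range] at hj
      obtain ⟨l, rfl⟩ := Nat.exists_eq_add_of_le (Nat.lt_succ_iff.mp hj)
      rw [shiftCoeff_add_right, ← add_assoc, shiftCoeff_add_right]
      have := Ring.choose_smul_choose (-(r : ℤ)) (Nat.le_add_right j l)
      have e : (-(r : ℤ)) - (j : ℤ) = -((r + j : ℕ) : ℤ) := by push_cast; ring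
      rw [e, Nat.add_sub_cancel_left, nsmul_eq_mul] at this
      have := congrArg (Int.cast (R := ℂ)) this
      push_cast at this
      rw [Nat.add_sub_cancel_left]
      push_cast
      linear_combination (-(a ^ l * b ^ j)) * this
    · intro q hq
      rw [shiftCoeff_of_lt b (Finset.mem_range.mp hq), mul_zero]
  · rw [shiftCoeff_of_lt _ (by omega)]
    refine Finset.sum_eq_zero fun q hq => ?_
    rw [Finset.mem_range] at hq
    rw [shiftCoeff_of_lt b (by omega), mul_zero]

section Shift

variable {A : Type*} [Ring A] [Algebra ℂ A]

/-- The upper end `n` is free because `shiftCoeff a r s` vanishes for `r > s`; coefficients of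
different order can thus be summed over one common range. -/
theorem coeff_seriesShift (a : ℂ) (f : PowerSeries A) {s n : ℕ} (h : s ≤ n) :
    coeff s (seriesShift a f) = ∑ r ∈ Finset.range (n + 1), shiftCoeff a r s • coeff r f := by
  rw [seriesShift, coeff_mk]
  refine (Finset.sum_congr rfl fun r hr => ?_).trans
    (Finset.sum_subset (Finset.range_subset_range.mpr (by omega)) fun r _ hr => ?_)
  · rw [Finset.mem_range] at hr
    rw [shiftCoeff, if_pos (by omega)]
  · rw [Finset.mem_range] at hr
    rw [shiftCoeff_of_lt a (by omega), zero_smul]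

theorem seriesShift_mul (a : ℂ) (f g : PowerSeries A) :
    seriesShift a (f * g) = seriesShift a f * seriesShift a g := by
  ext s
  have key : ∀ r, shiftCoeff a r s • coeff r (f * g) = ∑ x ∈ Finset.HasAntidiagonal.antidiagonal r,
      shiftCoeff a (x.1 + x.2) s • (coeff x.1 f * coeff x.2 g) := by
    intro r
    rw [coeff_mul, Finset.smul_sum]
    refine Finset.sum_congr rfl fun x hx => ?_
    rw [Finset.HasAntidiagonal.mem_antidiagonal.mp hx]
  rw [coeff_seriesShift a _ le_rfl, coeff_mul]
  simp_rw [key]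
  rw [Finset.sum_sigma']
  -- Both sides are compared with a sum over a full square of pairs; the pairs with `i + j > s`
  -- contribute zero.
  trans ∑ i ∈ Finset.range (s + 1) ×ˢ Finset.range (s + 1),
      shiftCoeff a (i.1 + i.2) s • (coeff i.1 f * coeff i.2 g)
  · refine Finset.sum_of_injOn (fun x => x.2) ?_ ?_ ?_ ?_
    · rintro ⟨r, x⟩ hx ⟨r', y⟩ hy hxy
      simp only [Finset.coe_sigma, Set.mem_sigma_iff, Finset.mem_coe,
        Finset.HasAntidiagonal.mem_antidiagonal] at hx hy hxy
      subst hxy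
      obtain rfl : r = r' := by rw [← hx.2, ← hy.2]
      rfl
    · rintro ⟨r, x⟩ hx
      simp only [Finset.coe_sigma, Set.mem_sigma_iff, Finset.mem_coe, Finset.mem_range,
        Finset.HasAntidiagonal.mem_antidiagonal, Finset.coe_product, Set.mem_prod] at hx ⊢
      omega
    · rintro ⟨i, j⟩ hx hx'
      rw [shiftCoeff_of_lt, zero_smul]
      by_contra hlt
      apply hx'
      refine ⟨⟨i + j, (i, j)⟩, ?_, rfl⟩
      simp only [Finset.coe_sigma, Set.mem_sigma_iff, Finset.mem_coe, Finset.mem_range,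
        Finset.HasAntidiagonal.mem_antidiagonal]
      refine ⟨?_, trivial⟩
      dsimp only at hlt ⊢
      omega
    · rintro ⟨r, x⟩ _
      rfl
  · simp_rw [shiftCoeff_add_left, Finset.sum_smul]
    rw [Finset.sum_comm]
    refine Finset.sum_congr rfl fun p hp => ?_
    have hp' := Finset.HasAntidiagonal.mem_antidiagonal.mp hp
    rw [coeff_seriesShift a f (show p.1 ≤ s by omega), coeff_seriesShift a g (show p.2 ≤ s by omega),
      Finset.sum_mul_sum, Finset.sum_product]
    refine Finset.sum_congr rfl fun i _ => Finset.sum_congr rfl fun j _ => ?_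
    rw [smul_mul_smul_comm]

theorem seriesShift_add (a : ℂ) (f g : PowerSeries A) :
    seriesShift a (f + g) = seriesShift a f + seriesShift a g := by
  ext s
  simp [coeff_seriesShift a _ (le_refl s), Finset.sum_add_distrib]

theorem seriesShift_C (a : ℂ) (b : A) : seriesShift a (C b) = C b := by
  ext s
  rw [coeff_seriesShift a _ le_rfl, Finset.sum_eq_single 0]
  · rw [shiftCoeff_zero_left, coeff_zero_C, coeff_C, ite_smul, one_smul, zero_smul]
  · intro r _ hr
    rw [coeff_C_of_ne_zero hr, smul_zero]
  · simp

/-- The shift `u ↦ u + a` as a ring homomorphism. -/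
def shiftHom (A : Type*) [Ring A] [Algebra ℂ A] (a : ℂ) : PowerSeries A →+* PowerSeries A where
  toFun := seriesShift a
  map_one' := by simpa using seriesShift_C a (1 : A)
  map_mul' := seriesShift_mul a
  map_zero' := by simpa using seriesShift_C a (0 : A)
  map_add' := seriesShift_add a

@[simp]
theorem shiftHom_apply (a : ℂ) (f : PowerSeries A) : shiftHom A a f = seriesShift a f := rfl

theorem seriesShift_seriesShift (a b : ℂ) (f : PowerSeries A) :
    seriesShift a (seriesShift b f) = seriesShift (a + b) f := by
  ext s
  rw [coeff_seriesShift a _ le_rfl, coeff_seriesShift (a + b) _ le_rfl]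
  have : ∀ q ∈ Finset.range (s + 1), shiftCoeff a q s • coeff q (seriesShift b f) =
      ∑ r ∈ Finset.range (s + 1), (shiftCoeff a q s * shiftCoeff b r q) • coeff r f := by
    intro q hq
    rw [coeff_seriesShift b f (Nat.lt_succ_iff.mp (Finset.mem_range.mp hq)), Finset.smul_sum]
    simp_rw [smul_smul]
  rw [Finset.sum_congr rfl this, Finset.sum_comm]
  simp_rw [← Finset.sum_smul, sum_shiftCoeff_mul]

theorem seriesShift_zero (f : PowerSeries A) : seriesShift 0 f = f := by
  ext s
  rw [coeff_seriesShift 0 _ le_rfl, Finset.sum_eq_single s]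
  · rw [shiftCoeff_self, one_smul]
  · intro r hr hrs
    rw [Finset.mem_range] at hr
    rw [shiftCoeff, if_pos (by omega), zero_pow (by omega), mul_zero, zero_smul]
  · simp

theorem constantCoeff_seriesShift (a : ℂ) (f : PowerSeries A) :
    constantCoeff (seriesShift a f) = constantCoeff f := by
  rw [← coeff_zero_eq_constantCoeff_apply, coeff_seriesShift a _ le_rfl]
  simp [shiftCoeff_self]

/-- That is, `(1 + a u⁻¹)(u + a)⁻¹ = u⁻¹`: the rule by which denominators are followed through a
shift. -/
theorem seriesShift_X (a : ℂ) :
    (1 + a • X) * seriesShift a (X : PowerSeries A) = X := by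
  have h : ∀ s, coeff s (seriesShift a (X : PowerSeries A)) = shiftCoeff a 1 s • (1 : A) := by
    intro s
    rw [coeff_seriesShift a _ (Nat.le_add_right s 1), Finset.sum_eq_single 1]
    · simp
    · intro r _ hr
      rw [coeff_X, if_neg hr, smul_zero]
    · simp
  have h1 : ∀ s, shiftCoeff a 1 (s + 1) = (-a) ^ s := by
    intro s
    have := shiftCoeff_add_right a 1 s
    rw [add_comm s 1, this, Ring.choose_neg]
    simp [Ring.choose_natCast, neg_pow a, Int.negOnePow, Units.smul_def]
  ext s
  rw [add_mul, one_mul, map_add, smul_mul_assoc, PowerSeries.coeff_smul]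
  rcases s with _ | _ | s
  · simp [h, shiftCoeff]
  · rw [coeff_succ_X_mul]
    simp [h, shiftCoeff, coeff_X]
  · rw [coeff_succ_X_mul, h, h, h1, h1, coeff_X, if_neg (by omega), smul_smul, ← add_smul, pow_succ]
    rw [mul_neg, add_comm (-_), mul_comm a, neg_mul_eq_neg_mul]
    simp

end Shift

end

section

/-! ### Series in two variables -/

section TwoVariables

variable (A : Type*) [Ring A]

/-- The ring homomorphism `f ↦ f(u)`. -/
def atUHom : PowerSeries A →+* PowerSeries (PowerSeries A) := PowerSeries.map (C (R := A))

/-- The ring homomorphism `f ↦ f(v)`. -/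
def atVHom : PowerSeries A →+* PowerSeries (PowerSeries A) := C (R := PowerSeries A)

/-- Exchanging the variables `u` and `v`. -/
def swapHom : PowerSeries (PowerSeries A) →+* PowerSeries (PowerSeries A) where
  toFun F := mk fun a => mk fun b => coeff a (coeff b F)
  map_one' := by
    ext a b
    simp only [coeff_mk, coeff_one, apply_ite (coeff _), map_zero]
    split_ifs <;> rfl
  map_zero' := by ext a b; simp
  map_add' F G := by ext a b; simp
  map_mul' F G := by
    ext a b
    simp only [coeff_mk, coeff_mul, map_sum]
    rw [Finset.sum_comm]

/-- Setting `v = u`. -/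
def diagHom : PowerSeries (PowerSeries A) →+* PowerSeries A where
  toFun F := mk fun n => ∑ p ∈ Finset.HasAntidiagonal.antidiagonal n, coeff p.2 (coeff p.1 F)
  map_one' := by
    ext n
    simp only [coeff_mk, coeff_one, apply_ite (coeff _), map_zero]
    rw [Finset.sum_eq_single (0, n)]
    · simp
    · rintro ⟨a, b⟩ h hne
      rw [Finset.HasAntidiagonal.mem_antidiagonal] at h
      rw [if_neg]
      rintro rfl
      exact hne (by simp_all)
    · simp
  map_zero' := by ext n; simp
  map_add' F G := by ext n; simp [Finset.sum_add_distrib]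
  map_mul' F G := by
    ext n
    simp only [coeff_mk, coeff_mul, map_sum, Finset.sum_mul_sum]
    simp only [Finset.sum_sigma']
    -- The summands are indexed by quadruples `(a1, a2, b1, b2)` of total `n`; the bijection
    -- exchanges the grouping by variable with the grouping by factor.
    refine Finset.sum_nbij'
      (fun x => ⟨(x.2.1.1 + x.2.2.1, x.2.1.2 + x.2.2.2), ⟨(x.2.1.1, x.2.2.1), (x.2.1.2, x.2.2.2)⟩⟩)
      (fun y => ⟨(y.2.1.1 + y.2.2.1, y.2.1.2 + y.2.2.2), ⟨(y.2.1.1, y.2.2.1), (y.2.1.2, y.2.2.2)⟩⟩)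
      ?_ ?_ ?_ ?_ ?_
    · rintro ⟨⟨a, b⟩, ⟨⟨a1, a2⟩, ⟨b1, b2⟩⟩⟩ h
      simp only [Finset.mem_sigma, Finset.HasAntidiagonal.mem_antidiagonal] at h ⊢
      refine ⟨?_, ?_, ?_⟩ <;> first | trivial | omega
    · rintro ⟨⟨a, b⟩, ⟨⟨a1, a2⟩, ⟨b1, b2⟩⟩⟩ h
      simp only [Finset.mem_sigma, Finset.HasAntidiagonal.mem_antidiagonal] at h ⊢
      refine ⟨?_, ?_, ?_⟩ <;> first | trivial | omega
    · rintro ⟨⟨a, b⟩, ⟨⟨a1, a2⟩, ⟨b1, b2⟩⟩⟩ h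
      simp only [Finset.mem_sigma, Finset.HasAntidiagonal.mem_antidiagonal] at h
      obtain ⟨_, rfl, rfl⟩ := h
      rfl
    · rintro ⟨⟨a, b⟩, ⟨⟨a1, a2⟩, ⟨b1, b2⟩⟩⟩ h
      simp only [Finset.mem_sigma, Finset.HasAntidiagonal.mem_antidiagonal] at h
      obtain ⟨_, rfl, rfl⟩ := h
      rfl
    · rintro ⟨⟨a, b⟩, ⟨⟨a1, a2⟩, ⟨b1, b2⟩⟩⟩ h
      rfl

variable {A}

theorem coeff_coeff_atU (f : PowerSeries A) (a b : ℕ) :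
    coeff b (coeff a (atU f)) = if b = 0 then coeff a f else 0 := by
  rw [atU, coeff_map, coeff_C]

theorem coeff_coeff_atV (f : PowerSeries A) (a b : ℕ) :
    coeff b (coeff a (atV f)) = if a = 0 then coeff b f else 0 := by
  rw [atV, coeff_C]
  split_ifs <;> simp

theorem swapHom_atU (f : PowerSeries A) : swapHom A (atU f) = atV f := by
  ext a b
  rw [coeff_coeff_atV]
  exact (by simp [swapHom] : coeff b (coeff a (swapHom A (atU f))) = _).trans
    (coeff_coeff_atU f b a)

theorem swapHom_atV (f : PowerSeries A) : swapHom A (atV f) = atU f := by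
  ext a b
  rw [coeff_coeff_atU]
  exact (by simp [swapHom] : coeff b (coeff a (swapHom A (atV f))) = _).trans
    (coeff_coeff_atV f b a)

theorem invU_eq : invU A = atU X := by
  rw [atU, map_X, invU]

theorem invV_eq : invV A = atV X := rfl

theorem swapHom_invU : swapHom A (invU A) = invV A := by
  rw [invU_eq, swapHom_atU, invV_eq]

theorem swapHom_invV : swapHom A (invV A) = invU A := by
  rw [invU_eq, ← swapHom_atV, invV_eq]

theorem diagHom_atU (f : PowerSeries A) : diagHom A (atU f) = f := by
  ext n
  refine (coeff_mk n fun n => ∑ p ∈ Finset.HasAntidiagonal.antidiagonal n,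
    coeff p.2 (coeff p.1 (atU f))).trans ?_
  simp only [coeff_coeff_atU]
  rw [Finset.sum_eq_single (n, 0)]
  · simp
  · rintro ⟨a, b⟩ h hne
    rw [Finset.HasAntidiagonal.mem_antidiagonal] at h
    rw [if_neg]
    rintro rfl
    exact hne (by simp_all)
  · simp

theorem diagHom_atV (f : PowerSeries A) : diagHom A (atV f) = f := by
  ext n
  refine (coeff_mk n fun n => ∑ p ∈ Finset.HasAntidiagonal.antidiagonal n,
    coeff p.2 (coeff p.1 (atV f))).trans ?_
  simp only [coeff_coeff_atV]
  rw [Finset.sum_eq_single (0, n)]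
  · simp
  · rintro ⟨a, b⟩ h hne
    rw [Finset.HasAntidiagonal.mem_antidiagonal] at h
    rw [if_neg]
    rintro rfl
    exact hne (by simp_all)
  · simp

theorem atU_mul (f g : PowerSeries A) : atU (f * g) = atU f * atU g := map_mul (atUHom A) f g

theorem atU_sub (f g : PowerSeries A) : atU (f - g) = atU f - atU g := map_sub (atUHom A) f g

theorem atU_one : atU (1 : PowerSeries A) = 1 := map_one (atUHom A)

theorem atV_mul (f g : PowerSeries A) : atV (f * g) = atV f * atV g := map_mul (atVHom A) f g

theorem atV_sub (f g : PowerSeries A) : atV (f - g) = atV f - atV g := map_sub (atVHom A) f g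

theorem atV_one : atV (1 : PowerSeries A) = 1 := map_one (atVHom A)

theorem commute_invU (F : PowerSeries (PowerSeries A)) : Commute (invU A) F :=
  (commute_X F).symm

theorem commute_invV (F : PowerSeries (PowerSeries A)) : Commute (invV A) F := by
  refine PowerSeries.ext fun n => ?_
  rw [invV, coeff_C_mul, coeff_mul_C, X_mul]

/-- The lowest nonzero coefficient of `F` would be annihilated by the constant term of `E`. This is
how factors such as `u - v - a` are cancelled. -/
theorem isLeftRegular_of_constantCoeff {S : Type*} [Ring S] {E : PowerSeries S}
    (hE : IsLeftRegular (constantCoeff E)) : IsLeftRegular E := by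
  refine isLeftRegular_iff_right_eq_zero_of_mul.mpr fun F hF => ?_
  ext n
  induction n using Nat.strong_induction_on with
  | _ n ih =>
    have h := congrArg (coeff n) hF
    rw [coeff_mul, Finset.sum_eq_single (0, n), map_zero] at h
    · exact isLeftRegular_iff_right_eq_zero_of_mul.mp hE _ (by simpa using h)
    · rintro ⟨a, b⟩ hab hne
      rw [Finset.HasAntidiagonal.mem_antidiagonal] at hab
      have : b < n := by
        rcases Nat.eq_zero_or_pos a with rfl | ha
        · exact absurd (by simp_all) hne
        · dsimp only at hab; omega
      rw [ih b this, map_zero, mul_zero]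
    · simp

theorem isLeftRegular_X : IsLeftRegular (X : PowerSeries A) := fun _ _ h => X_mul_cancel h

variable [Algebra ℂ A]

/-- Setting `v = u - a`. -/
def evalHom (A : Type*) [Ring A] [Algebra ℂ A] (a : ℂ) :
    PowerSeries (PowerSeries A) →+* PowerSeries A :=
  (diagHom A).comp (PowerSeries.map (shiftHom A (-a)))

/-- The shift `v ↦ v + a`. -/
def shiftVHom (A : Type*) [Ring A] [Algebra ℂ A] (a : ℂ) :
    PowerSeries (PowerSeries A) →+* PowerSeries (PowerSeries A) :=
  PowerSeries.map (shiftHom A a)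

theorem shiftVHom_atU (a : ℂ) (f : PowerSeries A) : shiftVHom A a (atU f) = atU f := by
  ext1 n
  simp [shiftVHom, atU, seriesShift_C]

theorem shiftVHom_atV (a : ℂ) (f : PowerSeries A) :
    shiftVHom A a (atV f) = atV (seriesShift a f) := by
  simp [shiftVHom, atV]

theorem evalHom_atU (a : ℂ) (f : PowerSeries A) : evalHom A a (atU f) = f :=
  (congrArg (diagHom A) (shiftVHom_atU (-a) f)).trans (diagHom_atU f)

theorem evalHom_atV (a : ℂ) (f : PowerSeries A) : evalHom A a (atV f) = seriesShift (-a) f :=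
  (congrArg (diagHom A) (shiftVHom_atV (-a) f)).trans (diagHom_atV _)

theorem seriesShift_smul (a b : ℂ) (f : PowerSeries A) :
    seriesShift a (b • f) = b • seriesShift a f := by
  ext s
  simp only [coeff_seriesShift a _ (le_refl s), PowerSeries.coeff_smul, Finset.smul_sum]
  exact Finset.sum_congr rfl fun r _ => smul_comm _ _ _

theorem map_smul_of_algHom {R S : Type*} [Ring R] [Algebra ℂ R] [Ring S] [Algebra ℂ S]
    (φ : R →+* S) (hφ : ∀ (b : ℂ) x, φ (b • x) = b • φ x) (b : ℂ) (f : PowerSeries R) :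
    PowerSeries.map φ (b • f) = b • PowerSeries.map φ f := by
  ext n
  simp [hφ]

theorem shiftVHom_smul (a b : ℂ) (F : PowerSeries (PowerSeries A)) :
    shiftVHom A a (b • F) = b • shiftVHom A a F :=
  map_smul_of_algHom _ (fun b f => seriesShift_smul a b f) _ _

theorem swapHom_smul (b : ℂ) (F : PowerSeries (PowerSeries A)) :
    swapHom A (b • F) = b • swapHom A F := by
  ext m n
  simp [swapHom]

theorem diagHom_smul (b : ℂ) (F : PowerSeries (PowerSeries A)) :
    diagHom A (b • F) = b • diagHom A F := by
  ext m
  simp [diagHom, Finset.smul_sum]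

theorem evalHom_smul (a b : ℂ) (F : PowerSeries (PowerSeries A)) :
    evalHom A a (b • F) = b • evalHom A a F :=
  (congrArg (diagHom A) (shiftVHom_smul (-a) b F)).trans (diagHom_smul _ _)

theorem commute_clearUVShift (a : ℂ) (F : PowerSeries (PowerSeries A)) :
    Commute (clearUVShift A a) F :=
  ((commute_invV F).sub_left (commute_invU F)).sub_left
    (((commute_invU F).mul_left (commute_invV F)).smul_left a)

theorem constantCoeff_clearUVShift (a : ℂ) : constantCoeff (clearUVShift A a) = X := by
  have h : constantCoeff (invU A) = 0 := constantCoeff_X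
  have h' : constantCoeff (a • (invU A * invV A)) = a • constantCoeff (invU A * invV A) := rfl
  rw [clearUVShift, map_sub, map_sub, h', map_mul, h, invV, constantCoeff_C]
  simp

theorem clearUVShift_zero : clearUVShift A 0 = clearUV A := by
  rw [clearUVShift, zero_smul, sub_zero, clearUV]

theorem isLeftRegular_clearUVShift (a : ℂ) : IsLeftRegular (clearUVShift A a) := by
  refine isLeftRegular_of_constantCoeff ?_
  rw [constantCoeff_clearUVShift]
  exact isLeftRegular_X

/-- `(u - v - b)` at `v = u - a`, cleared of denominators. -/
theorem evalHom_clearUVShift (a b : ℂ) :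
    evalHom A a (clearUVShift A b) = (a - b) • (X * seriesShift (-a) X) := by
  have h := seriesShift_X (A := A) (-a)
  rw [add_mul, one_mul, smul_mul_assoc] at h
  rw [clearUVShift, invU_eq, invV_eq, map_sub, map_sub, evalHom_smul, map_mul, evalHom_atU,
    evalHom_atV]
  -- The lone `X` is expanded as `u⁻¹ = (u - a)⁻¹ - a u⁻¹ (u - a)⁻¹`.
  nth_rewrite 2 [← h]
  module

theorem isLeftRegular_X_mul_shift_X (a : ℂ) :
    IsLeftRegular (X * seriesShift a X : PowerSeries A) := by
  have h : IsLeftRegular (seriesShift a X : PowerSeries A) := by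
    intro f g hfg
    have := congrArg ((1 + a • X) * ·) hfg
    simp only [← mul_assoc, seriesShift_X] at this
    exact X_mul_cancel this
  exact isLeftRegular_X.mul h

/-- The center of the ring of series in two variables. -/
abbrev TwoVarCenter (A : Type*) [Ring A] [Algebra ℂ A] :
    Subalgebra ℂ (PowerSeries (PowerSeries A)) :=
  Subalgebra.center ℂ (PowerSeries (PowerSeries A))

/-- With the center as ring of scalars, the factors `u - v` and `u⁻¹ v⁻¹` become elements of a
commutative ring. The same abstract identities then apply over this center, and over `ℂ` once `u -
v` is specialized to a number. -/
instance : Algebra (TwoVarCenter A) (PowerSeries (PowerSeries A)) :=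
  Algebra.ofModule (fun r x y => by simp [Subalgebra.smul_def, mul_assoc]) fun r x y => by
    simp only [Subalgebra.smul_def, smul_eq_mul]
    rw [← mul_assoc, ← mul_assoc, Subalgebra.mem_center_iff.mp r.2 x]

instance : IsScalarTower ℂ (TwoVarCenter A) (PowerSeries (PowerSeries A)) :=
  ⟨fun a r x => by simp [Subalgebra.smul_def]⟩

end TwoVariables

end

section

/-! ### Schur complements and quadratic exchange relations -/

section Abstract

variable {k B : Type*} [CommRing k] [Ring B] [Algebra k B]

/-- Commuting a generator past a Schur complement. -/
theorem exchange_schurComplement {Z c d e : k}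
    {T til tkj tol tko tij' til' tkj' tio' toj' tol' tko' a' α' : B}
    (ha : a' * α' = 1) (ha' : α' * a' = 1)
    (h0 : Z • (T * tij' - (c * d) • (tij' * T)) = (c * e) • (til * tkj' - til' * tkj))
    (h1 : Z • (T * tio' - c • (tio' * T)) = (c * e) • (til * tko' - til' * tko))
    (h2 : Z • (T * toj' - d • (toj' * T)) = e • (tol * tkj' - tol' * tkj))
    (h3 : Z • (T * a' - a' * T) = e • (tol * tko' - tol' * tko)) :
    Z • (T * (tij' - tio' * α' * toj') - (c * d) • ((tij' - tio' * α' * toj') * T)) =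
      (c * e) • ((til - tio' * α' * tol) * (tkj' - tko' * α' * toj') -
        (til' - tio' * α' * tol') * (tkj - tko * α' * toj')) := by
  have ha2 : ∀ x, a' * (α' * x) = x := fun x => by rw [← mul_assoc, ha, one_mul]
  have ha2' : ∀ x, α' * (a' * x) = x := fun x => by rw [← mul_assoc, ha', one_mul]
  -- `T` passes through `tio' * α' * toj'` factor by factor. Passing it through the inverse `α'` is
  -- the relation with `a'`, multiplied by `α'` on both sides.
  have h1' := congrArg (· * (α' * toj')) h1
  have h2' := congrArg (tio' * α' * ·) h2
  have h3' := congrArg (fun x => tio' * α' * x * (α' * toj')) h3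
  simp only [mul_sub, sub_mul, smul_mul_assoc, mul_smul_comm, mul_assoc, ha2, ha2', smul_sub]
    at h0 h1' h2' h3' ⊢
  linear_combination (norm := module) h0 - h1' + c • h3' - c • h2'

/-- The quadratic exchange relation satisfied by Schur complements, up to a factor `Z`. -/
theorem schurComplement_exchange {Z W p q r w x : k}
    {tkl til tkj a α bl bj ci ck fi' ej' Xij' Xil' Xkj' Xkl' : B}
    (ha : α * a = 1)
    (cij : α * Xij' = Xij' * α) (cil : α * Xil' = Xil' * α)
    (ckl : α * Xkl' = Xkl' * α)
    (h0 : Z • (tkl * Xij' - (p * q) • (Xij' * tkl)) =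
      (W * (q * w * r)) • ((til - fi' * bl) * Xkj' - Xil' * (tkj - ck * ej')))
    (h1 : Z • (bl * Xij' - q • (Xij' * bl)) = -(W * (q * w)) • (Xil' * (bj - a * ej')))
    (h2 : Z • (ck * Xij' - p • (Xij' * ck)) = (W * x) • ((ci - fi' * a) * Xkj'))
    (h3 : Z • ((w * r) • (bl * Xkj') - x • (Xkj' * bl)) =
      -(W * x * w) • (Xkl' * (bj - a * ej')))
    (h4 : Z • (ck * Xil' - r • (Xil' * ck)) = (W * x) • ((ci - fi' * a) * Xkl'))
    (ckj : α * Xkj' = Xkj' * α) (ha' : a * α = 1) :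
    Z • (Z • ((tkl - ck * α * bl) * Xij' - (p * q) • (Xij' * (tkl - ck * α * bl))) -
      (W * (q * w * r)) • ((til - ci * α * bl) * Xkj' - Xil' * (tkj - ck * α * bj))) = 0 := by
  have ha2 : ∀ y, α * (a * y) = y := fun y => by rw [← mul_assoc, ha, one_mul]
  have ha2' : ∀ y, a * (α * y) = y := fun y => by rw [← mul_assoc, ha', one_mul]
  have cij2 : ∀ y, α * (Xij' * y) = Xij' * (α * y) := fun y => by
    rw [← mul_assoc, cij, mul_assoc]
  have cil2 : ∀ y, α * (Xil' * y) = Xil' * (α * y) := fun y => by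
    rw [← mul_assoc, cil, mul_assoc]
  have ckj2 : ∀ y, α * (Xkj' * y) = Xkj' * (α * y) := fun y => by
    rw [← mul_assoc, ckj, mul_assoc]
  have ckl2 : ∀ y, α * (Xkl' * y) = Xkl' * (α * y) := fun y => by
    rw [← mul_assoc, ckl, mul_assoc]
  -- Here `a` is the corner at `u`, the `b`'s and `c`'s its row and column, `X'` the Schur
  -- complement at `v`, `fi'` stands for `t'_{io} α'` and `ej'` for `α' t'_{oj}`. The corrections
  -- `h1'` and `h2'` move `X'` past `ck * α * bl`; `h3'` and `h4'` turn the half-reduced entries on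
  -- the right into Schur complements. The last two carry no `Z` in the combination, which is why
  -- the conclusion has an additional factor `Z`.
  have h1' := congrArg (ck * α * ·) h1
  have h2' := congrArg (· * (α * bl)) h2
  have h3' := congrArg ((ci - fi' * a) * α * ·) h3
  have h4' := congrArg (· * (α * (bj - a * ej'))) h4
  simp only [mul_sub, sub_mul, smul_mul_assoc, mul_smul_comm, mul_assoc, ha2, ha2', smul_sub, cij2, cil2, ckj2, ckl2, neg_smul, mul_neg]
    at h0 h1' h2' h3' h4' ⊢
  linear_combination (norm := module) Z • h0 - Z • h1' - (Z * q) • h2' + (W * q) • h3' +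
    (W * q * w) • h4'

/-- The sign `(-1)^a` as a scalar. -/
def scalarSign (k : Type*) [CommRing k] (a : ZMod 2) : k := if a = 0 then 1 else -1

theorem scalarSign_add (a b : ZMod 2) :
    scalarSign k (a + b) = scalarSign k a * scalarSign k b := by
  have : ∀ c : ZMod 2, c = 0 ∨ c = 1 := by decide
  have h : (1 : ZMod 2) + 1 = 0 := by decide
  rcases this a with rfl | rfl <;> rcases this b with rfl | rfl <;> simp [scalarSign, h]

theorem scalarSign_zero : scalarSign k 0 = 1 := by simp [scalarSign]

theorem scalarSign_mul_self (a : ZMod 2) : scalarSign k a * scalarSign k a = 1 := by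
  rw [← scalarSign_add, CharTwo.add_self_eq_zero, scalarSign_zero]

variable {ι : Type*}

/-- The exchange relation of the Yangian of `gl` between `t_{ij}(u)` and `t_{kl}(v)`, with
`W / Z` in place of `1 / (u - v)`. -/
def ExchangeRel (Z W : k) (p : ι → ZMod 2) (t t' : ι → ι → B) (i j k' l : ι) : Prop :=
  Z • (t i j * t' k' l - scalarSign k ((p i + p j) * (p k' + p l)) • (t' k' l * t i j)) =
    (W * scalarSign k (p i * p j + p i * p k' + p j * p k')) •
      (t k' j * t' i l - t' k' j * t i l)

/-- The Schur complement of the corner `(o, o)`, where `α` is the inverse of the corner entry. -/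
def schurEntry (t : ι → ι → B) (o : ι) (α : B) (i j : ι) : B := t i j - t i o * α * t o j

variable {Z W : k} {p : ι → ZMod 2} {t t' : ι → ι → B} {o : ι} {α α' : B}

/-- Elimination on the `v` side only. The right-hand side contains entries that mix `u` and `v`;
they become Schur complements when the `u` side is eliminated too. -/
theorem ExchangeRel.schurEntry_right {i j k' l : ι} (ha : t' o o * α' = 1) (ha' : α' * t' o o = 1)
    (h0 : ExchangeRel Z W p t t' k' l i j) (h1 : ExchangeRel Z W p t t' k' l i o)
    (h2 : ExchangeRel Z W p t t' k' l o j) (h3 : ExchangeRel Z W p t t' k' l o o) :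
    Z • (t k' l * schurEntry t' o α' i j -
        scalarSign k ((p k' + p l) * (p i + p j)) • (schurEntry t' o α' i j * t k' l)) =
      (W * scalarSign k (p k' * p l + p k' * p i + p l * p i)) •
        ((t i l - t' i o * α' * t o l) * schurEntry t' o α' k' j -
          schurEntry t' o α' i l * (t k' j - t k' o * α' * t' o j)) := by
  have s1 : scalarSign k ((p k' + p l) * (p i + p j)) =
      scalarSign k ((p k' + p l) * (p i + p o)) * scalarSign k ((p k' + p l) * (p o + p j)) := by
    rw [← scalarSign_add]
    congr 1
    generalize p i = a, p j = b, p k' = c, p l = d, p o = e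
    decide +revert
  have s2 : W * scalarSign k (p k' * p l + p k' * p i + p l * p i) =
      scalarSign k ((p k' + p l) * (p i + p o)) *
        (W * scalarSign k (p k' * p l + p k' * p o + p l * p o)) := by
    rw [mul_left_comm, ← scalarSign_add]
    congr 2
    generalize p i = a, p k' = c, p l = d, p o = e
    decide +revert
  have s3 : (p k' + p l) * (p o + p o) = 0 := by
    rw [CharTwo.add_self_eq_zero, mul_zero]
  unfold ExchangeRel at h0 h1 h2 h3
  rw [s3, scalarSign_zero, one_smul] at h3
  rw [s2] at h0 h1
  rw [s1] at h0 ⊢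
  rw [s2]
  exact exchange_schurComplement ha ha' h0 h1 h2 h3

theorem schurEntry_corner_left (ha : t o o * α = 1) (j : ι) : schurEntry t o α o j = 0 := by
  rw [schurEntry, ha, one_mul, sub_self]

theorem schurEntry_corner_right (ha : α * t o o = 1) (i : ι) : schurEntry t o α i o = 0 := by
  rw [schurEntry, mul_assoc, ha, mul_one, sub_self]

/-- The corner entry commutes with the Schur complement. -/
theorem corner_commute_schurEntry {i j : ι} (hZ : ∀ y : B, Z • y = 0 → y = 0)
    (ha : t' o o * α' = 1) (ha' : α' * t' o o = 1)
    (h0 : ExchangeRel Z W p t t' o o i j) (h1 : ExchangeRel Z W p t t' o o i o)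
    (h2 : ExchangeRel Z W p t t' o o o j) (h3 : ExchangeRel Z W p t t' o o o o) :
    Commute (t o o) (schurEntry t' o α' i j) := by
  -- For the corner in place of `t k' l`, the right-hand side involves Schur entries in row or
  -- column `o`, which are zero.
  have h := ExchangeRel.schurEntry_right ha ha' h0 h1 h2 h3
  rw [schurEntry_corner_left ha, schurEntry_corner_right ha', mul_zero, zero_mul, sub_zero,
    smul_zero, CharTwo.add_self_eq_zero, zero_mul, scalarSign_zero, one_smul] at h
  exact sub_eq_zero.mp (hZ _ h)

/-- Schur complements satisfy the exchange relations. -/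
theorem exchangeRel_schurEntry {G : ι → ι → Prop} (hG : ∀ x, G o x) (hG' : ∀ x, G x o)
    (hZ : ∀ y : B, Z • y = 0 → y = 0)
    (hα : t o o * α = 1) (hα' : α * t o o = 1)
    (ha : t' o o * α' = 1) (ha' : α' * t' o o = 1)
    (hR : ∀ r c r' c', G r r' → G c c' → ExchangeRel Z W p t t' r c r' c')
    {k' l i j : ι} (hki : G k' i) (hlj : G l j) :
    ExchangeRel Z W p (schurEntry t o α) (schurEntry t' o α') k' l i j := by
  have comm : ∀ i j, α * schurEntry t' o α' i j = schurEntry t' o α' i j * α := by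
    intro i j
    have h := corner_commute_schurEntry (i := i) (j := j) hZ ha ha' (hR _ _ _ _ (hG _) (hG _))
      (hR _ _ _ _ (hG _) (hG _)) (hR _ _ _ _ (hG _) (hG _)) (hR _ _ _ _ (hG _) (hG _))
    calc α * schurEntry t' o α' i j = α * (schurEntry t' o α' i j * t o o) * α := by
          rw [mul_assoc, mul_assoc, hα, mul_one]
      _ = schurEntry t' o α' i j * α := by
          rw [← h.eq, ← mul_assoc, hα', one_mul]
  have key : ∀ {k' l i j}, G k' i → G l j → _ := fun {k' l i j} hki hlj =>
    ExchangeRel.schurEntry_right (i := i) (j := j) (k' := k') (l := l) ha ha'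
      (hR _ _ _ _ hki hlj) (hR _ _ _ _ hki (hG' _)) (hR _ _ _ _ (hG' _) hlj)
      (hR _ _ _ _ (hG' _) (hG' _))
  have h0 := key hki hlj
  have h1 := key (hG i) hlj
  have h2 := key hki (hG j)
  have h3 := key (hG k') hlj
  have h4 := key hki (hG l)
  rw [schurEntry_corner_left ha, mul_zero, zero_sub, mul_assoc (t o o), smul_neg, ← neg_smul]
    at h1 h3
  rw [schurEntry_corner_right ha', zero_mul, sub_zero] at h2 h4
  -- The signs of the five half-reduced relations, needed in the factored form that the abstract
  -- identity expects. Each factorization is an identity of polynomials over `ZMod 2`.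
  set p1 := scalarSign k ((p k' + p o) * (p i + p j)) with hp1
  set q := scalarSign k ((p o + p l) * (p i + p j)) with hq
  set x := scalarSign k (p k' * p o + p k' * p i + p o * p i) with hx
  set g := scalarSign k ((p o + p l) * (p k' + p j)) with hg
  set r := scalarSign k ((p k' + p o) * (p i + p l)) with hr
  set z := scalarSign k (p o * p l + p o * p k' + p l * p k') with hz
  have e1 : scalarSign k ((p k' + p l) * (p i + p j)) = p1 * q := by
    rw [hp1, hq, ← scalarSign_add]
    congr 1
    generalize p i = a, p j = b, p k' = c, p l = d, p o = e
    decide +revert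
  have e2 : scalarSign k (p k' * p l + p k' * p i + p l * p i) = q * (z * g) * r := by
    rw [hq, hz, hg, hr, ← scalarSign_add, ← scalarSign_add, ← scalarSign_add]
    congr 1
    generalize p i = a, p j = b, p k' = c, p l = d, p o = e
    decide +revert
  have e3 : scalarSign k (p o * p l + p o * p i + p l * p i) = q * (z * g) := by
    rw [hq, hz, hg, ← scalarSign_add, ← scalarSign_add]
    congr 1
    generalize p i = a, p j = b, p k' = c, p l = d, p o = e
    decide +revert
  have e4 : x * g = z * g * r := by
    rw [hx, hz, hg, hr, ← scalarSign_add, ← scalarSign_add, ← scalarSign_add]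
    congr 1
    generalize p i = a, p j = b, p k' = c, p l = d, p o = e
    decide +revert
  have e5 : g * g = 1 := scalarSign_mul_self _
  rw [e1, e2] at h0
  rw [e3] at h1
  have h3' : Z • ((z * g * r) • (t o l * schurEntry t' o α' k' j) -
      x • (schurEntry t' o α' k' j * t o l)) =
      -(W * x * (z * g)) •
        (schurEntry t' o α' k' l * (t o j - t o o * (α' * t' o j))) := by
    have := congrArg ((x * g) • ·) h3
    rw [smul_comm, smul_sub, smul_smul, mul_assoc x, e5, mul_one, e4, smul_smul] at this
    rw [this]
    congr 1
    linear_combination (W * z) * e4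
  rw [mul_assoc (t k' o) α'] at h0
  have h := schurComplement_exchange hα' (comm i j) (comm i l) (comm k' l) h0 h1 h2 h3' h4
    (comm k' j) hα
  unfold ExchangeRel
  rw [e1, e2]
  exact sub_eq_zero.mp (hZ _ h)

/-- The Schur complement of the transposed matrix at `u` in terms of the Schur complement at
`v = u - (-1)^{|o|}`. -/
theorem transposed_schurEntry {p : ι → ZMod 2} {t t' : ι → ι → B} {o : ι} {α α' : B} {i j : ι}
    (hα : t o o * α = 1) (ha : t' o o * α' = 1)
    (h1 : ExchangeRel (scalarSign k (p o)) 1 p t t' o o i o)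
    (h2 : ExchangeRel (scalarSign k (p o)) 1 p t t' o o o j)
    (h3 : ExchangeRel (scalarSign k (p o)) 1 p t t' i o o j) :
    t' o o * (t i j - scalarSign k ((p i + p o) * (p o + p j)) • (t o j * α * t i o)) =
      t o o * schurEntry t' o α' i j := by
  set s := scalarSign k (p o) with hs
  have hss : s * s = 1 := scalarSign_mul_self _
  have sq : ∀ a : ZMod 2, a * a = a := by decide
  have cancel : ∀ x y : B, s • x = s • y → x = y := fun x y h => by
    have := congrArg (s • ·) h
    simpa only [smul_smul, hss, one_smul] using this
  have e1 : p o * p o + p o * p i + p o * p i = p o := by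
    rw [add_assoc, CharTwo.add_self_eq_zero, add_zero, sq]
  have e2 : p o * p o + p o * p o + p o * p o = p o := by
    rw [CharTwo.add_self_eq_zero, zero_add, sq]
  have e3 : p i * p o + p i * p o + p o * p o = p o := by
    rw [CharTwo.add_self_eq_zero, zero_add, sq]
  unfold ExchangeRel at h1 h2 h3
  rw [CharTwo.add_self_eq_zero, zero_mul, scalarSign_zero, one_smul, one_mul, e1] at h1
  rw [CharTwo.add_self_eq_zero, zero_mul, scalarSign_zero, one_smul, one_mul, e2] at h2
  rw [one_mul, e3] at h3
  -- At `u - v = (-1)^{|o|}` the scalar `Z` equals the sign on the right, so both cancel and one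
  -- product drops out of each relation, leaving two-term identities.
  have r1 : t o o * t' i o = t i o * t' o o := sub_left_injective (cancel _ _ h1)
  have r2 : t' o o * t o j = t' o j * t o o := (sub_right_injective (cancel _ _ h2)).symm
  have r3 := cancel _ _ h3
  have r4 : t' o o * (t o j * α * t i o) = t' o j * t i o := by
    rw [← mul_assoc, ← mul_assoc, r2, mul_assoc (t' o j), hα, mul_one]
  have r5 : t o o * (t' i o * α' * t' o j) = t i o * t' o j := by
    rw [← mul_assoc, ← mul_assoc, r1, mul_assoc (t i o), ha, mul_one]
  rw [schurEntry, mul_sub, mul_sub, mul_smul_comm, r4, r5, sub_eq_sub_iff_add_eq_add]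
  rw [sub_eq_sub_iff_add_eq_add] at r3
  rw [add_comm (t' o o * t i j), r3]

end Abstract

end

section

/-! ### Series with coefficients in a subalgebra -/

section CoeffsIn

variable {A : Type*} [Ring A] [Algebra ℂ A] {S : Subalgebra ℂ A} {f g : PowerSeries A}

/-- All coefficients of the series lie in the subalgebra. -/
def CoeffsIn (S : Subalgebra ℂ A) (f : PowerSeries A) : Prop := ∀ n, coeff n f ∈ S

/-- Lifting to series over `S` makes closure under inverses and Gauss decompositions automatic. -/
theorem coeffsIn_iff : CoeffsIn S f ↔ ∃ g : PowerSeries S, PowerSeries.map S.val.toRingHom g = f := by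
  constructor
  · intro h
    exact ⟨mk fun n => ⟨coeff n f, h n⟩, by ext n; simp⟩
  · rintro ⟨g, rfl⟩ n
    rw [coeff_map]
    exact (coeff n g).2

theorem CoeffsIn.mul (hf : CoeffsIn S f) (hg : CoeffsIn S g) : CoeffsIn S (f * g) := by
  intro n
  rw [coeff_mul]
  exact S.sum_mem fun x _ => S.mul_mem (hf _) (hg _)

theorem coeffsIn_one : CoeffsIn S (1 : PowerSeries A) := by
  intro n
  rw [coeff_one]
  split_ifs
  exacts [S.one_mem, S.zero_mem]

theorem CoeffsIn.list_prod {l : List (PowerSeries A)} (h : ∀ f ∈ l, CoeffsIn S f) :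
    CoeffsIn S l.prod := by
  induction l with
  | nil => exact coeffsIn_one
  | cons f l ih =>
    rw [List.prod_cons]
    exact (h _ List.mem_cons_self).mul (ih fun g hg => h g (List.mem_cons_of_mem _ hg))

theorem CoeffsIn.seriesShift (hf : CoeffsIn S f) (a : ℂ) : CoeffsIn S (seriesShift a f) := by
  intro n
  rw [coeff_seriesShift a f le_rfl]
  exact S.sum_mem fun r _ => S.smul_mem (hf r) _

theorem isUnit_of_constantCoeff_eq_one (hf : constantCoeff f = 1) : IsUnit f :=
  ⟨⟨f, invOfUnit f 1, mul_invOfUnit _ _ hf, invOfUnit_mul _ _ hf⟩, rfl⟩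

theorem ringInverse_eq_of_mul_eq_one {R : Type*} [Ring R] {x y : R} (h : x * y = 1)
    (h' : y * x = 1) : Ring.inverse x = y :=
  Ring.inverse_unit ⟨x, y, h, h'⟩

theorem CoeffsIn.ringInverse (hf : CoeffsIn S f) (h1 : constantCoeff f = 1) :
    CoeffsIn S (Ring.inverse f) := by
  obtain ⟨g, rfl⟩ := coeffsIn_iff.mp hf
  have hg : constantCoeff g = ((1 : Sˣ) : S) := by
    rw [← coeff_zero_eq_constantCoeff_apply, coeff_map] at h1
    rw [← coeff_zero_eq_constantCoeff_apply]
    exact Subtype.ext h1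
  refine coeffsIn_iff.mpr ⟨invOfUnit g 1, (ringInverse_eq_of_mul_eq_one ?_ ?_).symm⟩
  · rw [← map_mul, mul_invOfUnit _ _ hg, map_one]
  · rw [← map_mul, invOfUnit_mul _ _ hg, map_one]

/-- Every coefficient of `f` commutes with every coefficient of `g`. -/
def CoeffsCommute (f g : PowerSeries A) : Prop := ∀ r s, Commute (coeff r f) (coeff s g)

theorem CoeffsCommute.symm (h : CoeffsCommute f g) : CoeffsCommute g f := fun r s => (h s r).symm

/-- Commutation is membership in centralizers, so the closure properties of `CoeffsIn` transfer to
it. -/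
theorem coeffsCommute_iff :
    CoeffsCommute f g ↔ ∀ r, CoeffsIn (Subalgebra.centralizer ℂ {coeff r f}) g := by
  refine forall_congr' fun r => forall_congr' fun s => ?_
  rw [Subalgebra.mem_centralizer_iff]
  simp [Commute, SemiconjBy]

theorem CoeffsCommute.commute (h : CoeffsCommute f g) : Commute f g := by
  refine PowerSeries.ext fun n => ?_
  rw [coeff_mul, coeff_mul, ← Finset.Nat.sum_antidiagonal_swap]
  exact Finset.sum_congr rfl fun x _ => (h _ _).eq

theorem CoeffsCommute.mul_right {g' : PowerSeries A} (h : CoeffsCommute f g)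
    (h' : CoeffsCommute f g') : CoeffsCommute f (g * g') :=
  coeffsCommute_iff.mpr fun r => (coeffsCommute_iff.mp h r).mul (coeffsCommute_iff.mp h' r)

theorem CoeffsCommute.list_prod_right {l : List (PowerSeries A)}
    (h : ∀ g ∈ l, CoeffsCommute f g) : CoeffsCommute f l.prod :=
  coeffsCommute_iff.mpr fun r => CoeffsIn.list_prod fun g hg => coeffsCommute_iff.mp (h g hg) r

theorem CoeffsCommute.shift_right (h : CoeffsCommute f g) (a : ℂ) :
    CoeffsCommute f (seriesShift a g) :=
  coeffsCommute_iff.mpr fun r => (coeffsCommute_iff.mp h r).seriesShift a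

theorem CoeffsCommute.inverse_right (h : CoeffsCommute f g) (h1 : constantCoeff g = 1) :
    CoeffsCommute f (Ring.inverse g) :=
  coeffsCommute_iff.mpr fun r => (coeffsCommute_iff.mp h r).ringInverse h1

theorem map_ringInverse_of_isUnit {R R' : Type*} [Ring R] [Ring R'] (φ : R →+* R') {x : R}
    (hx : IsUnit x) : φ (Ring.inverse x) = Ring.inverse (φ x) := by
  refine (ringInverse_eq_of_mul_eq_one ?_ ?_).symm
  · rw [← map_mul, Ring.mul_inverse_cancel x hx, map_one]
  · rw [← map_mul, Ring.inverse_mul_cancel x hx, map_one]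

theorem coeff_coeff_atU_mul_atV (f g : PowerSeries A) (a b : ℕ) :
    coeff b (coeff a (atU f * atV g)) = coeff a f * coeff b g := by
  rw [atV, coeff_mul_C, atU, coeff_map, coeff_C_mul]

theorem coeff_coeff_atV_mul_atU (f g : PowerSeries A) (a b : ℕ) :
    coeff b (coeff a (atV g * atU f)) = coeff b g * coeff a f := by
  rw [atV, coeff_C_mul, atU, coeff_map, coeff_mul_C]

/-- The coefficient of `u^{-a} v^{-b}` in `f(u) g(v)` is a single product, so one identity in two
variables encodes all commutators. -/
theorem coeffsCommute_iff_atU_atV : CoeffsCommute f g ↔ Commute (atU f) (atV g) := by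
  constructor
  · intro h
    refine PowerSeries.ext fun a => PowerSeries.ext fun b => ?_
    rw [coeff_coeff_atU_mul_atV, coeff_coeff_atV_mul_atU]
    exact h a b
  · intro h a b
    have := congrArg (fun F => coeff b (coeff a F)) h.eq
    simp only [coeff_coeff_atU_mul_atV, coeff_coeff_atV_mul_atU] at this
    exact this

end CoeffsIn

/-! ### Functoriality of the Gauss decomposition -/

section Gauss

theorem IsGaussDecomposition.map {S S' : Type*} [Ring S] [Ring S'] {d : ℕ}
    {T F E : Matrix (Fin d) (Fin d) S} {h : Fin d → S} (hG : IsGaussDecomposition T F h E)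
    (φ : S →+* S') :
    IsGaussDecomposition (T.map φ) (F.map φ) (fun i => φ (h i)) (E.map φ) where
  lower_diag i := by simp [hG.lower_diag]
  lower_zero i j hij := by simp [hG.lower_zero i j hij]
  upper_diag i := by simp [hG.upper_diag]
  upper_zero i j hij := by simp [hG.upper_zero i j hij]
  eq_mul := by
    rw [hG.eq_mul, Matrix.map_mul, Matrix.map_mul, Matrix.diagonal_map (map_zero φ)]

/-- Multiplication by a unit from the left rescales the diagonal part. -/
theorem IsGaussDecomposition.unit_mul {S : Type*} [Ring S] {d : ℕ}
    {T F E : Matrix (Fin d) (Fin d) S} {h : Fin d → S} (hG : IsGaussDecomposition T F h E)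
    {z z' : S} (hz : z * z' = 1) (hz' : z' * z = 1) :
    IsGaussDecomposition (Matrix.of fun i j => z * T i j)
      (Matrix.of fun i j => z * F i j * z') (fun i => z * h i) E where
  lower_diag i := by simp [hG.lower_diag, hz]
  lower_zero i j hij := by simp [hG.lower_zero i j hij]
  upper_diag := hG.upper_diag
  upper_zero := hG.upper_zero
  eq_mul := by
    ext1 i j
    have := congrFun (congrFun hG.eq_mul i) j
    rw [Matrix.mul_apply] at this ⊢
    simp only [Matrix.mul_diagonal, Matrix.of_apply] at this ⊢
    rw [this, Finset.mul_sum]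
    refine Finset.sum_congr rfl fun l _ => ?_
    simp only [mul_assoc]
    rw [← mul_assoc z' z, hz', one_mul]

variable {A : Type*} [Ring A] {d : ℕ}
  {T F E : Matrix (Fin d) (Fin d) (PowerSeries A)} {h : Fin d → PowerSeries A}

theorem IsGaussDecomposition.constantCoeff_diag (hG : IsGaussDecomposition T F h E)
    (hT : ∀ i j, constantCoeff (T i j) = if i = j then 1 else 0) (i : Fin d) :
    constantCoeff (h i) = 1 := by
  induction d with
  | zero => exact i.elim0
  | succ d ih =>
    have h00 : constantCoeff (T 0 0) = ((1 : Aˣ) : A) := by simp [hT]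
    obtain ⟨p1, p2, p3, p4⟩ := hG.peel (mul_invOfUnit _ _ h00)
    cases i using Fin.cases with
    | zero => rw [p1, hT, if_pos rfl]
    | succ i => exact ih p4 (fun i j => by simp [hT]) i

/-- The diagonal part has coefficients in any subalgebra which contains the coefficients of the
matrix. -/
theorem IsGaussDecomposition.coeffsIn_diag [Algebra ℂ A] {S : Subalgebra ℂ A}
    (hG : IsGaussDecomposition T F h E)
    (hT : ∀ i j, constantCoeff (T i j) = if i = j then 1 else 0)
    (hS : ∀ i j, CoeffsIn S (T i j)) (i : Fin d) : CoeffsIn S (h i) := by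
  -- The matrix is decomposed over the subalgebra; uniqueness identifies the result with the given
  -- decomposition.
  choose U hU using fun i j => coeffsIn_iff.mp (hS i j)
  obtain ⟨h', F', E', hG'⟩ := exists_gaussDecomposition (Matrix.of U) (by
    intro i j
    have := hT i j
    rw [← hU, ← coeff_zero_eq_constantCoeff_apply, coeff_map] at this
    rw [← coeff_zero_eq_constantCoeff_apply]
    apply Subtype.ext
    simp only [Matrix.of_apply]
    refine (show S.val.toRingHom (coeff 0 (U i j)) = _ from this).trans ?_
    split_ifs <;> rfl)
  have hm := hG'.map (PowerSeries.map S.val.toRingHom)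
  rw [show (Matrix.of U).map (PowerSeries.map S.val.toRingHom) = T from by ext1 i j; exact hU i j]
    at hm
  rw [(gaussDecomposition_unique T hT hG hm).2.1]
  exact coeffsIn_iff.mpr ⟨_, rfl⟩

end Gauss

end

/-! ### Matrices with the relations of the Yangian of `gl`: Schur complements and commuting diagonal
parts -/

section

section GeneralLinear

variable {A : Type*} [Ring A] [Algebra ℂ A]

/-- `u⁻¹ v⁻¹ (u - v - a)` as a central element. -/
def centralClear (A : Type*) [Ring A] [Algebra ℂ A] (a : ℂ) : TwoVarCenter A :=
  ⟨clearUVShift A a, Subalgebra.mem_center_iff.mpr fun b => (commute_clearUVShift a b).symm⟩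

/-- `u⁻¹ v⁻¹` as a central element. -/
def centralInv (A : Type*) [Ring A] [Algebra ℂ A] : TwoVarCenter A :=
  ⟨invU A * invV A, Subalgebra.mem_center_iff.mpr fun b =>
    ((commute_invU b).mul_left (commute_invV b)).symm⟩

theorem centralClear_smul (a : ℂ) (F : PowerSeries (PowerSeries A)) :
    centralClear A a • F = clearUVShift A a * F := rfl

theorem centralInv_smul (F : PowerSeries (PowerSeries A)) :
    centralInv A • F = invU A * invV A * F := rfl

theorem centralClear_smul_eq_zero (a : ℂ) (F : PowerSeries (PowerSeries A))
    (h : centralClear A a • F = 0) : F = 0 :=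
  isLeftRegular_iff_right_eq_zero_of_mul.mp (isLeftRegular_clearUVShift a) F h

theorem centralClear_eq (a : ℂ) : centralClear A a = centralClear A 0 - a • centralInv A := by
  apply Subtype.ext
  simp [centralClear, centralInv, clearUVShift]

theorem scalarSign_smul {k B : Type*} [CommRing k] [Ring B] [Algebra k B] [Algebra ℂ B] (a : ZMod 2)
    (b : B) : scalarSign k a • b = scalarSign ℂ a • b := by
  unfold scalarSign
  split_ifs <;> simp

theorem scalarSign_complex (a : ZMod 2) : scalarSign ℂ a = paritySign a := rfl

/-- The exchange relation between the series `t_{ij}(u)` and `t_{kl}(v)`. -/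
def GLRel {ι : Type*} (p : ι → ZMod 2) (T : ι → ι → PowerSeries A) (i j k l : ι) : Prop :=
  ExchangeRel (centralClear A 0) (centralInv A) p (fun i j => atU (T i j))
    (fun i j => atV (T i j)) i j k l

/-- The exchange relation at `v = u - a`. -/
theorem GLRel.eval {ι : Type*} {p : ι → ZMod 2} {T : ι → ι → PowerSeries A} {i j k l : ι}
    (h : GLRel p T i j k l) (a : ℂ) :
    ExchangeRel a 1 p T (fun i j => seriesShift (-a) (T i j)) i j k l := by
  unfold GLRel ExchangeRel at h
  unfold ExchangeRel
  rw [mul_smul] at h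
  simp only [scalarSign_smul, centralClear_smul, centralInv_smul] at h
  have h2 := congrArg (evalHom A a) h
  simp only [map_mul, map_sub, evalHom_smul, evalHom_atU, evalHom_atV, evalHom_clearUVShift,
    sub_zero, invU_eq, invV_eq, smul_mul_assoc] at h2
  rw [← mul_smul_comm] at h2
  rw [one_mul]
  exact isLeftRegular_X_mul_shift_X (-a) h2

/-- The matrix satisfies the exchange relations of the Yangian of `gl`, except possibly those
between two entries in the same row `i`, or in the same column `i`, when `i` is not good. -/
structure IsPartialRTT {d : ℕ} (p : Fin d → ZMod 2) (good : Fin d → Prop)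
    (T : Matrix (Fin d) (Fin d) (PowerSeries A)) : Prop where
  constantCoeff_eq : ∀ i j, constantCoeff (T i j) = if i = j then 1 else 0
  rel : ∀ i j k l, (i ≠ k ∨ good i) → (j ≠ l ∨ good j) → GLRel p T i j k l

variable {d : ℕ} {p : Fin (d + 1) → ZMod 2} {good : Fin (d + 1) → Prop}
  {T : Matrix (Fin (d + 1)) (Fin (d + 1)) (PowerSeries A)} {b : PowerSeries A}

/-- The corner entry commutes with itself. -/
theorem IsPartialRTT.corner_self (hT : IsPartialRTT p good T) (h0 : good 0) :
    CoeffsCommute (T 0 0) (T 0 0) := by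
  rw [coeffsCommute_iff_atU_atV]
  have h := hT.rel 0 0 0 0 (Or.inr h0) (Or.inr h0)
  have sq : p 0 * p 0 + p 0 * p 0 + p 0 * p 0 = p 0 := by
    generalize p 0 = a
    decide +revert
  unfold GLRel ExchangeRel at h
  -- With `ε = (-1)^{|0|}`, the relation reads `(u - v) D = ε D` for `D = [t_{00}(u), t_{00}(v)]`,
  -- so `(u - v - ε) D = 0`.
  rw [CharTwo.add_self_eq_zero, zero_mul, scalarSign_zero, one_smul, sq, mul_smul,
    scalarSign_smul, ← smul_comm (scalarSign ℂ (p 0)), ← smul_assoc, ← sub_eq_zero, ← sub_smul,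
    ← centralClear_eq] at h
  exact sub_eq_zero.mp (centralClear_smul_eq_zero _ _ h)

theorem atV_schurEntry (i j : Fin (d + 1)) :
    atV (schurEntry T 0 b i j) = schurEntry (fun i j => atV (T i j)) 0 (atV b) i j := by
  simp only [schurEntry, atV_sub, atV_mul]

theorem atU_schurEntry (i j : Fin (d + 1)) :
    atU (schurEntry T 0 b i j) = schurEntry (fun i j => atU (T i j)) 0 (atU b) i j := by
  simp only [schurEntry, atU_sub, atU_mul]

theorem zero_ne_or_good (h0 : good 0) (x : Fin (d + 1)) : (0 : Fin (d + 1)) ≠ x ∨ good 0 :=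
  Or.inr h0

theorem ne_zero_or_good (h0 : good 0) (x : Fin (d + 1)) : x ≠ 0 ∨ good x := by
  by_cases h : x = 0
  · exact Or.inr (h ▸ h0)
  · exact Or.inl h

/-- The corner entry commutes with the Schur complement. -/
theorem IsPartialRTT.corner_schur (hT : IsPartialRTT p good T) (h0 : good 0)
    (hab : T 0 0 * b = 1) (hba : b * T 0 0 = 1) (i j : Fin (d + 1)) :
    CoeffsCommute (T 0 0) (schurEntry T 0 b i j) := by
  rw [coeffsCommute_iff_atU_atV, atV_schurEntry]
  refine corner_commute_schurEntry (t := fun i j => atU (T i j)) (k := TwoVarCenter A)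
    (centralClear_smul_eq_zero 0)
    (by rw [← atV_mul, hab, atV_one]) (by rw [← atV_mul, hba, atV_one])
    (hT.rel _ _ _ _ ?_ ?_) (hT.rel _ _ _ _ ?_ ?_) (hT.rel _ _ _ _ ?_ ?_)
    (hT.rel _ _ _ _ ?_ ?_) <;> exact zero_ne_or_good h0 _

/-- The Schur complement satisfies the exchange relations. -/
theorem IsPartialRTT.schur (hT : IsPartialRTT p good T) (h0 : good 0)
    (hab : T 0 0 * b = 1) (hba : b * T 0 0 = 1) :
    IsPartialRTT (fun i : Fin d => p i.succ) (fun i => good i.succ)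
      (Matrix.of fun i j : Fin d => T i.succ j.succ - T i.succ 0 * b * T 0 j.succ) where
  constantCoeff_eq i j := by simp [hT.constantCoeff_eq]
  rel i j k l hik hjl := by
    have hik' : i.succ ≠ k.succ ∨ good i.succ := hik.imp_left fun h h' => h (Fin.succ_injective _ h')
    have hjl' : j.succ ≠ l.succ ∨ good j.succ := hjl.imp_left fun h h' => h (Fin.succ_injective _ h')
    have h := exchangeRel_schurEntry (k := TwoVarCenter A) (p := p) (o := (0 : Fin (d + 1)))
      (G := fun i k => i ≠ k ∨ good i) (t := fun i j => atU (T i j)) (t' := fun i j => atV (T i j))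
      (zero_ne_or_good h0) (ne_zero_or_good h0) (centralClear_smul_eq_zero 0)
      (by rw [← atU_mul, hab, atU_one]) (by rw [← atU_mul, hba, atU_one])
      (by rw [← atV_mul, hab, atV_one]) (by rw [← atV_mul, hba, atV_one])
      hT.rel hik' hjl'
    unfold GLRel
    unfold ExchangeRel at h ⊢
    simp only [← atU_schurEntry, ← atV_schurEntry] at h
    exact h

/-- The diagonal entries of the Gauss decomposition commute. -/
theorem IsPartialRTT.diag_commute {d : ℕ} {p : Fin d → ZMod 2} {good : Fin d → Prop}
    {T F E : Matrix (Fin d) (Fin d) (PowerSeries A)} {h : Fin d → PowerSeries A}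
    (hT : IsPartialRTT p good T) (hgood : ∀ i : Fin d, (i : ℕ) + 1 < d → good i)
    (hG : IsGaussDecomposition T F h E) (i j : Fin d) (hij : i ≠ j ∨ good i) :
    CoeffsCommute (h i) (h j) := by
  induction d with
  | zero => exact i.elim0
  | succ d ih =>
    have h00 : constantCoeff (T 0 0) = ((1 : Aˣ) : A) := by simp [hT.constantCoeff_eq]
    have hab := mul_invOfUnit _ _ h00
    have hba := invOfUnit_mul _ _ h00
    obtain ⟨p1, -, -, p4⟩ := hG.peel hab
    -- The later `h j.succ` are computed from the Schur complement, whose coefficients lie in the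
    -- centralizer of every coefficient of the corner.
    have first : ∀ j : Fin d, CoeffsCommute (h 0) (h j.succ) := by
      intro j
      have h0 : good 0 := hgood 0 (by have := j.2; simp; omega)
      rw [coeffsCommute_iff]
      intro r
      refine p4.coeffsIn_diag (hT.schur h0 hab hba).constantCoeff_eq (fun i j => ?_) j
      rw [p1]
      exact coeffsCommute_iff.mp (hT.corner_schur h0 hab hba i.succ j.succ) r
    cases i using Fin.cases with
    | zero =>
      cases j using Fin.cases with
      | zero =>
        rw [p1]
        exact hT.corner_self (by simpa using hij)
      | succ j => exact first j
    | succ i =>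
      cases j using Fin.cases with
      | zero => exact (first i).symm
      | succ j =>
        have h0 : good 0 := hgood 0 (by have := j.2; simp; omega)
        exact ih (hT.schur h0 hab hba) (fun i hi => hgood i.succ (by simpa using hi)) p4 i j
          (hij.imp_left fun h h' => h (congrArg _ h'))

end GeneralLinear

end

/-! ### The Gauss decomposition of the supertranspose -/

section

section TransposedGauss

variable {A : Type*} [Ring A] [Algebra ℂ A]

/-- The partial sum of the signs of the first `s` indices. -/
def partialSignSum {d : ℕ} (p : Fin d → ZMod 2) (s : ℕ) : ℂ :=
  ∑ k : Fin d, if (k : ℕ) < s then scalarSign ℂ (p k) else 0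

theorem partialSignSum_zero {d : ℕ} (p : Fin d → ZMod 2) : partialSignSum p 0 = 0 := by
  simp [partialSignSum]

theorem partialSignSum_succ {d : ℕ} (p : Fin (d + 1) → ZMod 2) (s : ℕ) :
    partialSignSum p (s + 1) = scalarSign ℂ (p 0) + partialSignSum (fun i => p i.succ) s := by
  simp [partialSignSum, Fin.sum_univ_succ]

/-- The ratio of two shifts of the series `h i`. -/
def shiftRatio {d : ℕ} (p : Fin d → ZMod 2) (h : Fin d → PowerSeries A) (i : Fin d) :
    PowerSeries A :=
  seriesShift (-partialSignSum p i) (h i) *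
    Ring.inverse (seriesShift (-partialSignSum p (i + 1)) (h i))

/-- The product of the ratios for the indices below `s`. -/
def shiftRatioProd {d : ℕ} (p : Fin d → ZMod 2) (h : Fin d → PowerSeries A) (s : ℕ)
    (hs : s ≤ d) : PowerSeries A :=
  ((List.finRange s).map fun i => shiftRatio p h (Fin.castLE hs i)).prod

/-- Deleting the first index lowers every partial sum by `(-1)^{|0|}`; this is the shift acquired in
each elimination step. -/
theorem shiftRatio_succ {d : ℕ} (p : Fin (d + 1) → ZMod 2) (h : Fin (d + 1) → PowerSeries A)
    (i : Fin d) (h1 : constantCoeff (h i.succ) = 1) :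
    shiftRatio p h i.succ = seriesShift (-scalarSign ℂ (p 0))
      (shiftRatio (fun i => p i.succ) (fun i => h i.succ) i) := by
  have hu : ∀ a, IsUnit (seriesShift a (h i.succ)) := fun a =>
    isUnit_of_constantCoeff_eq_one (by rw [constantCoeff_seriesShift, h1])
  rw [shiftRatio, shiftRatio, seriesShift_mul, ← shiftHom_apply _ (Ring.inverse _),
    map_ringInverse_of_isUnit _ (hu _), shiftHom_apply, seriesShift_seriesShift,
    seriesShift_seriesShift, Fin.val_succ, partialSignSum_succ, partialSignSum_succ, neg_add,
    neg_add]

theorem shiftRatioProd_succ {d : ℕ} (p : Fin (d + 1) → ZMod 2) (h : Fin (d + 1) → PowerSeries A)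
    (h1 : ∀ i, constantCoeff (h i) = 1) (s : ℕ) (hs : s ≤ d) :
    shiftRatioProd p h (s + 1) (Nat.succ_le_succ hs) = shiftRatio p h 0 *
      seriesShift (-scalarSign ℂ (p 0))
        (shiftRatioProd (fun i => p i.succ) (fun i => h i.succ) s hs) := by
  rw [shiftRatioProd, List.finRange_succ, List.map_cons, List.prod_cons, List.map_map,
    shiftRatioProd, ← shiftHom_apply _ (List.prod _), map_list_prod, List.map_map]
  congr 3
  funext i
  exact shiftRatio_succ p h (Fin.castLE hs i) (h1 _)

/-- The matrix with entries `(-1)^{|i||j| + |i|} t_{ji}`. -/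
def superTranspose {d : ℕ} (p : Fin d → ZMod 2) (T : Matrix (Fin d) (Fin d) (PowerSeries A)) :
    Matrix (Fin d) (Fin d) (PowerSeries A) :=
  Matrix.of fun i j => scalarSign ℂ (p i * p j + p i) • T j i

theorem superTranspose_constantCoeff {d : ℕ} {p : Fin d → ZMod 2}
    {T : Matrix (Fin d) (Fin d) (PowerSeries A)}
    (hT : ∀ i j, constantCoeff (T i j) = if i = j then 1 else 0) (i j : Fin d) :
    constantCoeff (superTranspose p T i j) = if i = j then 1 else 0 := by
  have h : constantCoeff (superTranspose p T i j) =
      scalarSign ℂ (p i * p j + p i) • constantCoeff (T j i) := rfl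
  rw [h, hT]
  by_cases hij : i = j
  · subst hij
    have : p i * p i + p i = 0 := by generalize p i = a; decide +revert
    rw [this, scalarSign_zero, one_smul]
  · rw [if_neg hij, if_neg (Ne.symm hij), smul_zero]

variable {d : ℕ} {p : Fin (d + 1) → ZMod 2} {good : Fin (d + 1) → Prop}
  {T : Matrix (Fin (d + 1)) (Fin (d + 1)) (PowerSeries A)} {b : PowerSeries A}

/-- The Schur complement of the supertransposed matrix. -/
theorem IsPartialRTT.superTranspose_schur (hT : IsPartialRTT p good T) (h0 : good 0)
    (hab : T 0 0 * b = 1) (hba : b * T 0 0 = 1) (i j : Fin d) :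
    superTranspose p T i.succ j.succ - superTranspose p T i.succ 0 * b * superTranspose p T 0 j.succ =
      seriesShift (-scalarSign ℂ (p 0)) b * T 0 0 *
        seriesShift (-scalarSign ℂ (p 0)) (superTranspose (fun i => p i.succ)
          (Matrix.of fun i j : Fin d => T i.succ j.succ - T i.succ 0 * b * T 0 j.succ) i j) := by
  set s := scalarSign ℂ (p 0) with hs
  have hab' : seriesShift (-s) (T 0 0) * seriesShift (-s) b = 1 := by
    rw [← seriesShift_mul, hab]; exact map_one (shiftHom A _)
  have hba' : seriesShift (-s) b * seriesShift (-s) (T 0 0) = 1 := by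
    rw [← seriesShift_mul, hba]; exact map_one (shiftHom A _)
  -- Rows and columns are exchanged by the transposition, hence `j.succ` and `i.succ` in reversed
  -- roles; the relations are evaluated at `v = u - s`.
  have key := transposed_schurEntry (k := ℂ) (p := p) (t := fun i j => T i j) (o := 0)
    (t' := fun i j => seriesShift (-s) (T i j)) (α := b) (α' := seriesShift (-s) b)
    (i := j.succ) (j := i.succ) hab hab'
    ((hT.rel _ _ _ _ (zero_ne_or_good h0 _) (zero_ne_or_good h0 _)).eval _)
    ((hT.rel _ _ _ _ (zero_ne_or_good h0 _) (zero_ne_or_good h0 _)).eval _)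
    ((hT.rel _ _ _ _ (ne_zero_or_good h0 _) (zero_ne_or_good h0 _)).eval _)
  have key2 := congrArg (seriesShift (-s) b * ·) key
  simp only [← mul_assoc, hba', one_mul] at key2
  have e1 : scalarSign ℂ (p i.succ * p 0 + p i.succ) * scalarSign ℂ (p 0 * p j.succ + p 0) =
      scalarSign ℂ (p i.succ * p j.succ + p i.succ) *
        scalarSign ℂ ((p j.succ + p 0) * (p 0 + p i.succ)) := by
    rw [← scalarSign_add, ← scalarSign_add]
    congr 1
    generalize p i.succ = x, p j.succ = y, p 0 = z
    decide +revert
  have e2 : seriesShift (-s) (schurEntry (fun i j => T i j) 0 b j.succ i.succ) =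
      schurEntry (fun i j => seriesShift (-s) (T i j)) 0 (seriesShift (-s) b) j.succ i.succ := by
    simp only [schurEntry, ← seriesShift_mul]
    exact map_sub (shiftHom A (-s)) _ _
  simp only [superTranspose, Matrix.of_apply, smul_mul_assoc, mul_smul_comm, smul_smul,
    seriesShift_smul]
  rw [show T j.succ i.succ - T j.succ 0 * b * T 0 i.succ =
    schurEntry (fun i j => T i j) 0 b j.succ i.succ from rfl, e2, ← key2, smul_sub, smul_smul,
    mul_comm (scalarSign ℂ (p 0 * p j.succ + p 0)), e1]

/-- The diagonal part of the Gauss decomposition of the supertransposed matrix. -/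
theorem IsPartialRTT.superTranspose_diag {d : ℕ} {p : Fin d → ZMod 2} {good : Fin d → Prop}
    {T F E F' E' : Matrix (Fin d) (Fin d) (PowerSeries A)} {h h' : Fin d → PowerSeries A}
    (hT : IsPartialRTT p good T) (hgood : ∀ i : Fin d, (i : ℕ) + 1 < d → good i)
    (hG : IsGaussDecomposition T F h E)
    (hG' : IsGaussDecomposition (superTranspose p T) F' h' E') (i : Fin d) :
    h' i = shiftRatioProd p h i i.2.le * seriesShift (-partialSignSum p i) (h i) := by
  induction d with
  | zero => exact i.elim0
  | succ d ih =>
    have h00 : constantCoeff (T 0 0) = ((1 : Aˣ) : A) := by simp [hT.constantCoeff_eq]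
    set b := invOfUnit (T 0 0) 1
    have hab : T 0 0 * b = 1 := mul_invOfUnit _ _ h00
    have hba : b * T 0 0 = 1 := invOfUnit_mul _ _ h00
    have e00 : superTranspose p T 0 0 = T 0 0 := by
      have : p 0 * p 0 + p 0 = 0 := by generalize p 0 = a; decide +revert
      rw [superTranspose, Matrix.of_apply, this, scalarSign_zero, one_smul]
    obtain ⟨p1, -, -, p4⟩ := hG.peel hab
    obtain ⟨q1, -, -, q4⟩ := hG'.peel (e00.symm ▸ hab)
    cases i using Fin.cases with
    | zero => simp [shiftRatioProd, partialSignSum_zero, seriesShift_zero, p1, q1, e00]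
    | succ i =>
      have h0 : good 0 := hgood 0 (by have := i.2; simp; omega)
      have hX := hT.schur h0 hab hba
      have h1 := hG.constantCoeff_diag hT.constantCoeff_eq
      obtain ⟨g, F₁, E₁, hg⟩ := exists_gaussDecomposition _
        (superTranspose_constantCoeff (p := fun i => p i.succ) hX.constantCoeff_eq)
      set s := scalarSign ℂ (p 0) with hs
      have hab' : seriesShift (-s) (T 0 0) * seriesShift (-s) b = 1 := by
        rw [← seriesShift_mul, hab]; exact map_one (shiftHom A _)
      have hba' : seriesShift (-s) b * seriesShift (-s) (T 0 0) = 1 := by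
        rw [← seriesShift_mul, hba]; exact map_one (shiftHom A _)
      have hz : seriesShift (-s) b * T 0 0 * (b * seriesShift (-s) (T 0 0)) = 1 := by
        rw [mul_assoc, ← mul_assoc (T 0 0), hab, one_mul, hba']
      have hz' : b * seriesShift (-s) (T 0 0) * (seriesShift (-s) b * T 0 0) = 1 := by
        rw [mul_assoc, ← mul_assoc (seriesShift (-s) (T 0 0)), hab', one_mul, hba]
      -- A unit on the left is absorbed in the lower factor and the diagonal, so the Gauss
      -- decomposition for the smaller matrix, shifted and scaled, is the one for the Schur
      -- complement of the supertranspose.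
      have hu := (hg.map (shiftHom A (-s))).unit_mul hz hz'
      have hmat : (Matrix.of fun i j : Fin d => superTranspose p T i.succ j.succ -
          superTranspose p T i.succ 0 * b * superTranspose p T 0 j.succ) =
          Matrix.of fun i j => seriesShift (-s) b * T 0 0 * (superTranspose (fun i => p i.succ)
            (Matrix.of fun i j : Fin d => T i.succ j.succ - T i.succ 0 * b * T 0 j.succ)).map
              (shiftHom A (-s)) i j := by
        ext1 i j
        exact hT.superTranspose_schur h0 hab hba i j
      rw [← hmat] at hu
      have hdiag := congrFun (gaussDecomposition_unique _ (fun i j => by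
        simp [superTranspose_constantCoeff hT.constantCoeff_eq]) q4 hu).2.1 i
      have hi := ih hX (fun i hi => hgood i.succ (by simpa using hi)) p4 hg i
      -- Elimination produces `h_0(u - s)⁻¹ h_0(u)`, while the ratio has the inverse on the right.
      have hcomm : Commute (T 0 0) (seriesShift (-s) b) := by
        have hc := ((hT.corner_self h0).shift_right (-s)).commute
        calc T 0 0 * seriesShift (-s) b
            = seriesShift (-s) b * (seriesShift (-s) (T 0 0) * T 0 0) * seriesShift (-s) b := by
              rw [← mul_assoc, hba', one_mul]
          _ = seriesShift (-s) b * T 0 0 := by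
              rw [← hc.eq, ← mul_assoc, mul_assoc _ _ (seriesShift (-s) b), hab', mul_one]
      have hr : shiftRatio p h 0 = seriesShift (-s) b * T 0 0 := by
        rw [shiftRatio, Fin.val_zero, partialSignSum_zero, neg_zero, seriesShift_zero,
          partialSignSum_succ, partialSignSum_zero, add_zero, p1,
          ringInverse_eq_of_mul_eq_one hab' hba', hcomm.eq]
      refine hdiag.trans ?_
      have hprod := shiftRatioProd_succ p h h1 i i.2.le
      simp only [Fin.val_succ]
      rw [hprod, hr, partialSignSum_succ, neg_add, ← seriesShift_seriesShift, mul_assoc _ (seriesShift _ _),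
        ← seriesShift_mul, ← hi]
      rfl

end TransposedGauss

end

/-! ### The cancellation behind centrality -/

section

section CrossingAbstract

variable {k B : Type*} [CommRing k] [Ring B] [Algebra k B] {d : ℕ}

/-- The exchange relations of `t` with `a` and with `b`, and `a * b = c · Id`, control the
commutator of `t i j` with `c`. -/
theorem commutator_of_crossing {z z' W s : k} {σ e₁ e₂ y : Fin d → k}
    {t a b : Matrix (Fin d) (Fin d) B} {c : B} (i j : Fin d)
    (hab : ∀ m l, ∑ q, a m q * b q l = if m = l then c else 0)
    (he₁ : e₁ i.rev = 1) (he₂ : ∀ q, e₂ q = y q.rev)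
    (h₁ : ∀ q, (z * z') • (t i j * a i q - σ q • (a i q * t i j)) =
      (W * z' * s) • (t i j * a i q - a i j * t i q) -
        (W * z) • ((if i = i.rev then ∑ r, e₁ r • (t r j * a r.rev q) else 0) -
          if q = j.rev then ∑ r, e₂ r • (a i r.rev * t i r) else 0))
    (h₂ : ∀ q, (z * z') • (σ q • (t i j * b q i) - b q i * t i j) =
      (W * z) • (b q i.rev * t i.rev j - y q • (t i q.rev * b j.rev i)) -
        (W * z' * s) • ((∑ r, b q r * t r j) - if q = j then ∑ r, t i r * b r i else 0)) :
    (z * z') • (t i j * c - c * t i j) =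
      (W * z' * s) • (t i j * c - c * t i j) -
        (W * z) • (if i = i.rev then t i j * c - c * t i j else 0) := by
  -- `M` is the state halfway, with `t i j` between `a` and `b`. Because the row of `a` is the row
  -- `i` of `t i j`, the error terms `N₁` and `N₂` of the two moves coincide and cancel in the sum
  -- of `g1` and `g2`.
  set M := ∑ q, σ q • (a i q * t i j * b q i) with hM
  set N₁ := ∑ q, a i j * t i q * b q i with hN₁
  set N₂ := ∑ q, y q • (a i q * t i q.rev * b j.rev i) with hN₂
  have hii : ∑ q, a i q * b q i = c := by rw [hab, if_pos rfl]
  have f1 : ∑ q, t i j * a i q * b q i = t i j * c := by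
    simp_rw [mul_assoc]; rw [← Finset.mul_sum, hii]
  have f2 : ∑ q, (if i = i.rev then ∑ r, e₁ r • (t r j * a r.rev q) else 0) * b q i =
      if i = i.rev then t i j * c else 0 := by
    split_ifs with hi
    · simp_rw [Finset.sum_mul, smul_mul_assoc, mul_assoc]
      rw [Finset.sum_comm]
      simp_rw [← Finset.smul_sum, ← Finset.mul_sum, hab]
      rw [Finset.sum_eq_single i.rev]
      · rw [Fin.rev_rev, if_pos rfl, he₁, one_smul, ← hi]
      · intro r _ hr
        rw [if_neg, mul_zero, smul_zero]
        rintro h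
        exact hr (by rw [← h, Fin.rev_rev])
      · simp
    · simp
  have f3 : ∑ q, (if q = j.rev then ∑ r, e₂ r • (a i r.rev * t i r) else 0) * b q i = N₂ := by
    rw [Finset.sum_eq_single j.rev]
    · rw [if_pos rfl, Finset.sum_mul, hN₂, ← Equiv.sum_comp Fin.revPerm]
      refine Finset.sum_congr rfl fun q _ => ?_
      rw [Fin.revPerm_apply, he₂, Fin.rev_rev, smul_mul_assoc]
    · intro q _ hq
      rw [if_neg hq, zero_mul]
    · simp
  have g1 : (z * z') • (t i j * c - M) = (W * z' * s) • (t i j * c - N₁) -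
      (W * z) • ((if i = i.rev then t i j * c else 0) - N₂) := by
    have h := Finset.sum_congr (rfl : Finset.univ = Finset.univ)
      fun q _ => congrArg (· * b q i) (h₁ q)
    simp only [sub_mul, smul_mul_assoc, ← Finset.smul_sum, Finset.sum_sub_distrib, f1, f2, f3] at h
    exact h
  have f4 : ∑ q, a i q * b q i * t i j = c * t i j := by rw [← Finset.sum_mul, hii]
  have f5 : ∑ q, a i q * b q i.rev * t i.rev j = if i = i.rev then c * t i j else 0 := by
    rw [← Finset.sum_mul, hab]
    split_ifs with hi
    · rw [← hi]
    · rw [zero_mul]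
  have f6 : ∑ q, a i q * ∑ r, b q r * t r j = c * t i j := by
    simp_rw [Finset.mul_sum, ← mul_assoc]
    rw [Finset.sum_comm]
    simp_rw [← Finset.sum_mul, hab, ite_mul, zero_mul]
    simp
  have f7 : ∑ q, a i q * (if q = j then ∑ r, t i r * b r i else 0) = N₁ := by
    simp_rw [mul_ite, mul_zero]
    rw [Finset.sum_ite_eq' Finset.univ j, if_pos (Finset.mem_univ _), Finset.mul_sum, hN₁]
    simp_rw [mul_assoc]
  have g2 : (z * z') • (M - c * t i j) = (W * z) • ((if i = i.rev then c * t i j else 0) - N₂) -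
      (W * z' * s) • (c * t i j - N₁) := by
    have h := Finset.sum_congr (rfl : Finset.univ = Finset.univ)
      fun q _ => congrArg (a i q * ·) (h₂ q)
    simp only [mul_sub, mul_smul_comm, ← Finset.smul_sum, Finset.sum_sub_distrib, f6, f7] at h
    simp only [← mul_assoc, f4, f5] at h
    exact h
  have g3 := congrArg₂ (· + ·) g1 g2
  split_ifs at g3 ⊢ with hi
  · linear_combination (norm := module) g3
  · linear_combination (norm := module) g3

end CrossingAbstract

end

section

/-! ### The relations of the extended Yangian -/

theorem paritySign_add (a b : ZMod 2) :
    paritySign (a + b) = paritySign a * paritySign b := scalarSign_add (k := ℂ) a b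

theorem paritySign_zero : paritySign 0 = 1 := scalarSign_zero

theorem paritySign_mul_self (a : ZMod 2) : paritySign a * paritySign a = 1 :=
  scalarSign_mul_self (k := ℂ) a

namespace OspParity

variable {N m : ℕ} (P : OspParity N m)

/-- A fixed point of `i ↦ i'` is even. -/
theorem par_eq_zero_of_rev_eq {i : Fin (N + 2 * m)} (hi : i.rev = i) : P.par i = 0 := by
  have h01 : ∀ a : ZMod 2, a = 0 ∨ a = 1 := by decide
  refine (h01 (P.par i)).resolve_right fun h1 => ?_
  set S := Finset.univ.filter fun i => P.par i = 1 with hS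
  have hiS : i ∈ S := by simp [hS, h1]
  have h0 : ∑ _x ∈ S.erase i, (1 : ZMod 2) = 0 := by
    -- There is at most one fixed index. Were it odd, the remaining odd indices would be paired by
    -- `i ↦ i'`, making `2m - 1` even.
    refine Finset.sum_involution (fun a _ => a.rev) ?_ ?_ ?_ ?_
    · intro a _
      decide
    · intro a ha _ haa
      refine (Finset.mem_erase.mp ha).1 (Fin.ext ?_)
      have e1 := congrArg Fin.val haa
      have e2 := congrArg Fin.val hi
      rw [Fin.val_rev] at e1 e2
      omega
    · intro a ha
      obtain ⟨h1, h2⟩ := Finset.mem_erase.mp ha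
      refine Finset.mem_erase.mpr ⟨fun h => h1 ?_, ?_⟩
      · rw [← Fin.rev_rev a, h, hi]
      · simp only [hS, Finset.mem_filter, Finset.mem_univ, true_and] at h2 ⊢
        rw [P.par_rev, h2]
    · intro a _
      exact Fin.rev_rev a
  rw [Finset.sum_const, nsmul_one, Finset.card_erase_of_mem hiS, hS, P.card_odd,
    ZMod.natCast_eq_zero_iff] at h0
  have hpos : 0 < 2 * m := by
    rw [← P.card_odd]
    exact Finset.card_pos.mpr ⟨i, hiS⟩
  omega

theorem theta_mul_self (i : Fin (N + 2 * m)) : P.theta i * P.theta i = 1 := by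
  unfold theta
  split_ifs
  · rw [one_mul]
  · exact paritySign_mul_self _

/-- Exactly one of `i`, `i'` lies in the first half, unless `i = i'`, and then the parity is even
and the sign is `1`. -/
theorem theta_mul_theta_rev (i : Fin (N + 2 * m)) :
    P.theta i * P.theta i.rev = paritySign (P.par i) := by
  have hi := i.2
  unfold theta
  rw [Fin.val_rev, P.par_rev]
  split_ifs with h1 h2 h2
  · have : i.rev = i := Fin.ext (by rw [Fin.val_rev]; omega)
    rw [P.par_eq_zero_of_rev_eq this, paritySign_zero, one_mul]
  · rw [one_mul]
  · rw [mul_one]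
  · omega

theorem theta_rev (i : Fin (N + 2 * m)) :
    P.theta i.rev = paritySign (P.par i) * P.theta i := by
  linear_combination P.theta i * P.theta_mul_theta_rev i - P.theta i.rev * P.theta_mul_self i

end OspParity

variable {N m : ℕ} (P : OspParity N m)

/-- The quotient map, applied to series in two variables. -/
def quotientSeriesHom :
    PowerSeries (PowerSeries (OspFree N m)) →+* PowerSeries (PowerSeries (ExtYangian P)) :=
  PowerSeries.map (PowerSeries.map (RingQuot.mkAlgHom ℂ (RttRel P)).toRingHom)

theorem quotientSeriesHom_smul (a : ℂ) (F : PowerSeries (PowerSeries (OspFree N m))) :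
    quotientSeriesHom P (a • F) = a • quotientSeriesHom P F :=
  map_smul_of_algHom _ (fun b f => map_smul_of_algHom _
    (fun b x => map_smul (RingQuot.mkAlgHom ℂ (RttRel P)) b x) b f) a F

theorem map_freeT (i j : Fin (N + 2 * m)) :
    PowerSeries.map (RingQuot.mkAlgHom ℂ (RttRel P)).toRingHom (freeT N m i j) =
      tMatrix P i j := by
  ext s
  rw [coeff_map]
  cases s with
  | zero =>
    simp only [freeT, tMatrix, coeff_mk, Matrix.of_apply]
    split_ifs
    · exact map_one _
    · exact map_zero _
  | succ r =>
    simp only [freeT, tMatrix, coeff_mk, Matrix.of_apply]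
    rfl

theorem quotientSeriesHom_atU (f : PowerSeries (OspFree N m)) :
    quotientSeriesHom P (atU f) =
      atU (PowerSeries.map (RingQuot.mkAlgHom ℂ (RttRel P)).toRingHom f) := by
  ext1 n
  simp [quotientSeriesHom, atU]

theorem quotientSeriesHom_atV (f : PowerSeries (OspFree N m)) :
    quotientSeriesHom P (atV f) =
      atV (PowerSeries.map (RingQuot.mkAlgHom ℂ (RttRel P)).toRingHom f) := by
  simp [quotientSeriesHom, atV]

theorem quotientSeriesHom_clearUVShift (a : ℂ) :
    quotientSeriesHom P (clearUVShift _ a) = clearUVShift (ExtYangian P) a := by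
  rw [clearUVShift, map_sub, map_sub, quotientSeriesHom_smul, map_mul, invU_eq, invV_eq,
    quotientSeriesHom_atU, quotientSeriesHom_atV, map_X, ← invU_eq, ← invV_eq, ← clearUVShift]

theorem quotientSeriesHom_rtt (i j k l : Fin (N + 2 * m)) :
    quotientSeriesHom P (rttLeft P i j k l) = quotientSeriesHom P (rttRight P i j k l) := by
  ext a b
  simp only [quotientSeriesHom, coeff_map]
  exact RingQuot.mkAlgHom_rel ℂ (RttRel.rtt i j k l a b)

/-- The first sum in the defining relations. -/
def leftSum (i j l : Fin (N + 2 * m)) : PowerSeries (PowerSeries (ExtYangian P)) :=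
  ∑ p : Fin (N + 2 * m),
    (paritySign (P.par i + P.par i * P.par j + P.par j * P.par p) * P.theta i * P.theta p) •
      (atU (tMatrix P p j) * atV (tMatrix P p.rev l))

/-- The second sum in the defining relations. -/
def rightSum (i j k : Fin (N + 2 * m)) : PowerSeries (PowerSeries (ExtYangian P)) :=
  ∑ p : Fin (N + 2 * m),
    (paritySign (P.par i * P.par k + P.par j * P.par k + P.par i * P.par p) *
        P.theta j.rev * P.theta p.rev) •
      (atV (tMatrix P k p.rev) * atU (tMatrix P i p))

/-- The defining relations in the extended Yangian. -/
theorem rtt_relation (i j k l : Fin (N + 2 * m)) :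
    (centralClear (ExtYangian P) 0 * centralClear (ExtYangian P) P.kappa) •
        (atU (tMatrix P i j) * atV (tMatrix P k l) -
          paritySign ((P.par i + P.par j) * (P.par k + P.par l)) •
            (atV (tMatrix P k l) * atU (tMatrix P i j))) =
      (centralInv (ExtYangian P) * centralClear (ExtYangian P) P.kappa) •
          (paritySign (P.par i * P.par j + P.par i * P.par k + P.par j * P.par k) •
            (atU (tMatrix P k j) * atV (tMatrix P i l) -
              atV (tMatrix P k j) * atU (tMatrix P i l))) -
        (centralInv (ExtYangian P) * centralClear (ExtYangian P) 0) •
          ((if k = i.rev then leftSum P i j l else 0) -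
            if l = j.rev then rightSum P i j k else 0) := by
  have h := quotientSeriesHom_rtt P i j k l
  have hc : quotientSeriesHom P (clearUV _) = clearUV _ := by
    simpa only [clearUVShift_zero] using quotientSeriesHom_clearUVShift P 0
  have hu : quotientSeriesHom P (invU _) = invU _ := by
    rw [invU_eq, quotientSeriesHom_atU, map_X, ← invU_eq]
  have hv : quotientSeriesHom P (invV _) = invV _ := by
    rw [invV_eq, quotientSeriesHom_atV, map_X, ← invV_eq]
  simp only [rttLeft, rttRight, map_mul, map_sub, quotientSeriesHom_smul, hc, hu, hv,
    quotientSeriesHom_clearUVShift, quotientSeriesHom_atU, quotientSeriesHom_atV, map_freeT,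
    apply_ite (quotientSeriesHom P), map_sum, map_zero] at h
  simp only [mul_smul, centralClear_smul, centralInv_smul, clearUVShift_zero]
  simp only [leftSum, rightSum, mul_assoc] at h ⊢
  exact h

end

/-! ### The residue at `u - v = κ`, and the scalar product `T(u - κ) T^t(u)` -/

section

variable {N m : ℕ} (P : OspParity N m)

theorem evalHom_centralClear_smul {A : Type*} [Ring A] [Algebra ℂ A] (a b : ℂ)
    (F : PowerSeries (PowerSeries A)) :
    evalHom A a (centralClear A b • F) = (a - b) • (X * seriesShift (-a) X * evalHom A a F) := by
  rw [centralClear_smul, map_mul, evalHom_clearUVShift, smul_mul_assoc]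

theorem evalHom_centralInv_smul {A : Type*} [Ring A] [Algebra ℂ A] (a : ℂ)
    (F : PowerSeries (PowerSeries A)) :
    evalHom A a (centralInv A • F) = X * seriesShift (-a) X * evalHom A a F := by
  rw [centralInv_smul, map_mul, map_mul, invU_eq, invV_eq, evalHom_atU, evalHom_atV]

/-- The residue of the defining relations at `u - v = a`. -/
theorem evalHom_eq_zero_of_residue {A : Type*} [Ring A] [Algebra ℂ A] {a : ℂ}
    {F G H : PowerSeries (PowerSeries A)}
    (h : (centralClear A 0 * centralClear A a) • F =
      (centralInv A * centralClear A a) • G - (centralInv A * centralClear A 0) • H)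
    (hG : a = 0 → evalHom A a G = 0) : evalHom A a H = 0 := by
  have reg := fun y => (isLeftRegular_iff_right_eq_zero_of_mul.mp
    (isLeftRegular_X_mul_shift_X (A := A) (-a))) y
  -- For `a = 0` the two clearing factors coincide, so one is cancelled before evaluating; this
  -- leaves `G` beside `H`, whence the assumption on `G`.
  by_cases ha : a = 0
  · subst ha
    have h1 : centralClear A 0 • (centralClear A 0 • F - centralInv A • (G - H)) = 0 := by
      rw [smul_sub, smul_smul, smul_smul, smul_sub, h, mul_comm (centralClear A 0), sub_self]
    have h2 := congrArg (evalHom A 0) (centralClear_smul_eq_zero _ _ h1)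
    rw [map_sub, evalHom_centralClear_smul, evalHom_centralInv_smul, sub_zero, zero_smul, map_zero,
      zero_sub, neg_eq_zero] at h2
    have h3 := reg _ h2
    rwa [map_sub, hG rfl, zero_sub, neg_eq_zero] at h3
  · have h2 := congrArg (evalHom A a) h
    rw [mul_comm (centralClear A 0), mul_comm (centralInv A) (centralClear A a), mul_smul, mul_smul,
      mul_smul, map_sub, evalHom_centralClear_smul, evalHom_centralClear_smul a a (centralInv A • G),
      sub_self, zero_smul, zero_smul, zero_sub, eq_comm, neg_eq_zero, evalHom_centralInv_smul, evalHom_centralClear_smul,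
      mul_smul_comm, sub_zero] at h2
    exact reg _ (reg _ ((smul_eq_zero.mp h2).resolve_left ha))

/-- The contracted form of the defining relations at `v = u - κ`. -/
theorem contraction_relation (i j k l : Fin (N + 2 * m)) :
    (if k = i.rev then evalHom _ P.kappa (leftSum P i j l) else 0) =
      if l = j.rev then evalHom _ P.kappa (rightSum P i j k) else 0 := by
  -- When `κ = 0`, the permutation term vanishes at `v = u`, as its two products become equal.
  have e := evalHom_eq_zero_of_residue (rtt_relation P i j k l) (fun h => by
    rw [h, evalHom_smul, map_sub, map_mul, map_mul, evalHom_atU, evalHom_atU, evalHom_atV,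
      evalHom_atV, neg_zero, seriesShift_zero, seriesShift_zero, sub_self, smul_zero])
  rw [map_sub, sub_eq_zero, apply_ite (evalHom _ _), apply_ite (evalHom _ _), map_zero] at e
  exact e

theorem evalHom_leftSum (i j l : Fin (N + 2 * m)) :
    evalHom _ P.kappa (leftSum P i j l) = ∑ p : Fin (N + 2 * m),
      (paritySign (P.par i + P.par i * P.par j + P.par j * P.par p) * P.theta i * P.theta p) •
        (tMatrix P p j * seriesShift (-P.kappa) (tMatrix P p.rev l)) := by
  simp only [leftSum, map_sum, evalHom_smul, map_mul, evalHom_atU, evalHom_atV]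

theorem evalHom_rightSum (i j k : Fin (N + 2 * m)) :
    evalHom _ P.kappa (rightSum P i j k) = ∑ p : Fin (N + 2 * m),
      (paritySign (P.par i * P.par k + P.par j * P.par k + P.par i * P.par p) *
        P.theta j.rev * P.theta p.rev) •
        (seriesShift (-P.kappa) (tMatrix P k p.rev) * tMatrix P i p) := by
  simp only [rightSum, map_sum, evalHom_smul, map_mul, evalHom_atU, evalHom_atV]

theorem mul_tTransposed_apply (i j k : Fin (N + 2 * m)) :
    ((tMatrix P).map (seriesShift (-P.kappa)) * tTransposed P) k i.rev =
      (paritySign (P.par i * P.par k + P.par j * P.par k + P.par i) * P.theta i.rev *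
        P.theta j.rev) • evalHom _ P.kappa (rightSum P i j k) := by
  rw [evalHom_rightSum, Matrix.mul_apply, Finset.smul_sum, ← Equiv.sum_comp Fin.revPerm]
  refine Finset.sum_congr rfl fun q _ => ?_
  rw [Fin.revPerm_apply, Matrix.map_apply, tTransposed, Matrix.of_apply, Fin.rev_rev, Fin.rev_rev,
    mul_smul_comm, smul_smul, P.par_rev, P.par_rev]
  congr 1
  have e1 : paritySign (P.par q * P.par i + P.par i) =
      paritySign (P.par i * P.par k + P.par j * P.par k + P.par i) *
        paritySign (P.par i * P.par k + P.par j * P.par k + P.par i * P.par q) := by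
    rw [← paritySign_add]
    congr 1
    generalize P.par i = a, P.par j = b, P.par k = c, P.par q = d
    decide +revert
  rw [e1]
  linear_combination (-(paritySign (P.par i * P.par k + P.par j * P.par k + P.par i) *
    paritySign (P.par i * P.par k + P.par j * P.par k + P.par i * P.par q) * P.theta q.rev *
      P.theta i.rev)) * P.theta_mul_self j.rev

/-- The diagonal value of `T(u - κ) T^t(u)`. -/
theorem mul_tTransposed_diag (i j : Fin (N + 2 * m)) :
    ((tMatrix P).map (seriesShift (-P.kappa)) * tTransposed P) i.rev i.rev =
      P.theta j.rev • ∑ p : Fin (N + 2 * m), (paritySign (P.par j * P.par p) * P.theta p) •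
        (tMatrix P p j * seriesShift (-P.kappa) (tMatrix P p.rev j.rev)) := by
  -- Both sums survive here, and the left one depends on `i` only through a sign. The other factors
  -- cancel this sign, so the value is independent of `i`.
  have h := contraction_relation P i j i.rev j.rev
  rw [if_pos rfl, if_pos rfl] at h
  rw [mul_tTransposed_apply P i j, ← h, evalHom_leftSum, Finset.smul_sum, Finset.smul_sum]
  refine Finset.sum_congr rfl fun q _ => ?_
  rw [smul_smul, smul_smul, P.par_rev]
  congr 1
  have e1 : paritySign (P.par i * P.par i + P.par j * P.par i + P.par i) *
      paritySign (P.par i + P.par i * P.par j + P.par j * P.par q) =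
      paritySign (P.par i) * paritySign (P.par j * P.par q) := by
    rw [← paritySign_add, ← paritySign_add]
    congr 1
    generalize P.par i = a, P.par j = b, P.par q = d
    decide +revert
  have e2 := P.theta_mul_theta_rev i
  have e3 := paritySign_mul_self (P.par i)
  linear_combination (P.theta i * P.theta i.rev * P.theta j.rev * P.theta q) * e1 +
    (P.theta j.rev * P.theta q * paritySign (P.par i) * paritySign (P.par j * P.par q)) * e2 +
    (P.theta j.rev * P.theta q * paritySign (P.par j * P.par q)) * e3

/-- `T(u - κ) T^t(u)` is a scalar matrix. -/
theorem exists_mul_tTransposed :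
    ∃ c, (tMatrix P).map (seriesShift (-P.kappa)) * tTransposed P =
      Matrix.diagonal fun _ => c := by
  by_cases hd : Nonempty (Fin (N + 2 * m))
  · obtain ⟨j⟩ := hd
    refine ⟨P.theta j.rev • ∑ p : Fin (N + 2 * m), (paritySign (P.par j * P.par p) * P.theta p) •
        (tMatrix P p j * seriesShift (-P.kappa) (tMatrix P p.rev j.rev)), ?_⟩
    ext1 k r
    rw [Matrix.diagonal_apply]
    split_ifs with hkr
    · subst hkr
      simpa using mul_tTransposed_diag P k.rev j
    -- For `k ≠ r` the left sum is absent and the right sum remains, hence is zero.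
    · have h := contraction_relation P r.rev j k j.rev
      rw [Fin.rev_rev, if_neg hkr, if_pos rfl] at h
      have := mul_tTransposed_apply P r.rev j k
      rwa [Fin.rev_rev, ← h, smul_zero] at this
  · exact ⟨1, by ext1 i; exact (hd ⟨i⟩).elim⟩

end

/-! ### The defining relations after `v ↦ v - κ` and after exchanging `u` and `v` -/

section

section Scalars

variable {A : Type*} [Ring A] [Algebra ℂ A]

/-- `1 + a v⁻¹` as a central element. -/
def centralOneAdd (A : Type*) [Ring A] [Algebra ℂ A] (a : ℂ) : TwoVarCenter A :=
  ⟨1 + a • invV A, Subalgebra.mem_center_iff.mpr fun b =>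
    ((Commute.one_left b).add_left ((commute_invV b).smul_left a)).symm⟩

theorem centralOneAdd_mul_shift (a : ℂ) :
    (1 + a • invV A) * atV (seriesShift a X) = invV A := by
  have h : 1 + a • invV A = atV (1 + a • X) := by
    ext1 n
    rw [atV, coeff_C, map_add, coeff_one, PowerSeries.coeff_smul, invV, coeff_C]
    split_ifs <;> simp
  rw [h, ← atV_mul, seriesShift_X, invV_eq]

/-- The factor `1 + a v⁻¹` turns the shifted denominator `(v + a)⁻¹` back into `v⁻¹`, so clearing
factors remain of the same form, with parameter `a + b`. -/
theorem centralOneAdd_smul_shiftVHom (a b : ℂ) (F : PowerSeries (PowerSeries A)) :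
    centralOneAdd A a • shiftVHom A a (centralClear A b • F) =
      centralClear A (a + b) • shiftVHom A a F := by
  have key : (1 + a • invV A) * (atV (seriesShift a X) - invU A - b • (invU A * atV (seriesShift a X))) =
      clearUVShift A (a + b) := by
    have h := centralOneAdd_mul_shift (A := A) a
    have hc : (1 + a • invV A) * (invU A * atV (seriesShift a X)) = invU A * invV A := by
      rw [← mul_assoc, ← (commute_invU (1 + a • invV A)).eq, mul_assoc, h]
    rw [mul_sub, mul_sub, h, mul_smul_comm, hc, add_mul, one_mul, smul_mul_assoc,
      ← (commute_invU (invV A)).eq, clearUVShift]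
    module
  rw [centralClear_smul, map_mul, centralClear_smul, ← key, clearUVShift, map_sub, map_sub,
    shiftVHom_smul, map_mul, invU_eq, invV_eq, shiftVHom_atU, shiftVHom_atV, mul_assoc]
  rfl

theorem centralOneAdd_smul_shiftVHom_inv (a : ℂ) (F : PowerSeries (PowerSeries A)) :
    centralOneAdd A a • shiftVHom A a (centralInv A • F) = centralInv A • shiftVHom A a F := by
  have h := centralOneAdd_mul_shift (A := A) a
  have hc : (1 + a • invV A) * (invU A * atV (seriesShift a X)) = invU A * invV A := by
    rw [← mul_assoc, ← (commute_invU (1 + a • invV A)).eq, mul_assoc, h]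
  have e : shiftVHom A a (invU A * invV A) = invU A * atV (seriesShift a X) := by
    rw [map_mul, invU_eq, invV_eq, shiftVHom_atU, shiftVHom_atV]
  rw [centralInv_smul, map_mul, e, centralInv_smul, ← hc, mul_assoc (1 + a • invV A)]
  rfl

theorem swapHom_centralClear_smul (b : ℂ) (F : PowerSeries (PowerSeries A)) :
    swapHom A (centralClear A b • F) = -(centralClear A (-b) • swapHom A F) := by
  rw [centralClear_smul, map_mul, centralClear_smul, ← neg_mul]
  congr 1
  rw [clearUVShift, clearUVShift, map_sub, map_sub, swapHom_smul, map_mul, swapHom_invU,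
    swapHom_invV, (commute_invV (invU A)).eq]
  module

theorem swapHom_centralInv_smul (F : PowerSeries (PowerSeries A)) :
    swapHom A (centralInv A • F) = centralInv A • swapHom A F := by
  rw [centralInv_smul, map_mul, centralInv_smul, map_mul, swapHom_invU, swapHom_invV,
    (commute_invV (invU A)).eq]

end Scalars

variable {N m : ℕ} (P : OspParity N m)

/-- The defining relations with `v` replaced by `v - κ`. -/
theorem rtt_relation_shift (i j k l : Fin (N + 2 * m)) :
    (centralClear (ExtYangian P) (-P.kappa) * centralClear (ExtYangian P) 0) •
        (atU (tMatrix P i j) * atV (seriesShift (-P.kappa) (tMatrix P k l)) -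
          paritySign ((P.par i + P.par j) * (P.par k + P.par l)) •
            (atV (seriesShift (-P.kappa) (tMatrix P k l)) * atU (tMatrix P i j))) =
      (centralInv (ExtYangian P) * centralClear (ExtYangian P) 0) •
          (paritySign (P.par i * P.par j + P.par i * P.par k + P.par j * P.par k) •
            (atU (tMatrix P k j) * atV (seriesShift (-P.kappa) (tMatrix P i l)) -
              atV (seriesShift (-P.kappa) (tMatrix P k j)) * atU (tMatrix P i l))) -
        (centralInv (ExtYangian P) * centralClear (ExtYangian P) (-P.kappa)) •
          ((if k = i.rev then ∑ p : Fin (N + 2 * m),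
              (paritySign (P.par i + P.par i * P.par j + P.par j * P.par p) * P.theta i *
                P.theta p) •
                (atU (tMatrix P p j) * atV (seriesShift (-P.kappa) (tMatrix P p.rev l))) else 0) -
            if l = j.rev then ∑ p : Fin (N + 2 * m),
              (paritySign (P.par i * P.par k + P.par j * P.par k + P.par i * P.par p) *
                P.theta j.rev * P.theta p.rev) •
                (atV (seriesShift (-P.kappa) (tMatrix P k p.rev)) * atU (tMatrix P i p))
              else 0) := by
  -- Every term carries two clearing factors, and each of them absorbs one factor `1 - κ v⁻¹`.
  have h := congrArg (fun F => centralOneAdd (ExtYangian P) (-P.kappa) •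
    (centralOneAdd (ExtYangian P) (-P.kappa) • shiftVHom (ExtYangian P) (-P.kappa) F)) (rtt_relation P i j k l)
  simp only [map_sub, smul_sub (centralOneAdd _ _), mul_smul (centralClear _ _), mul_smul (centralInv _),
    centralOneAdd_smul_shiftVHom, centralOneAdd_smul_shiftVHom_inv,
    smul_comm (centralOneAdd (ExtYangian P) _) (centralClear (ExtYangian P) _),
    smul_comm (centralOneAdd (ExtYangian P) _) (centralInv (ExtYangian P))] at h
  simp only [add_zero, neg_add_cancel] at h
  simp only [map_sub, map_mul, map_sum, map_zero, shiftVHom_smul, shiftVHom_atU, shiftVHom_atV,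
    leftSum, rightSum, apply_ite (shiftVHom (ExtYangian P) _)] at h
  rw [mul_smul, mul_smul, mul_smul]
  exact h

/-- The defining relations with `u` and `v` exchanged. -/
theorem rtt_relation_swap (i j k l : Fin (N + 2 * m)) :
    (centralClear (ExtYangian P) (-P.kappa) * centralClear (ExtYangian P) 0) •
        (atV (tMatrix P i j) * atU (tMatrix P k l) -
          paritySign ((P.par i + P.par j) * (P.par k + P.par l)) •
            (atU (tMatrix P k l) * atV (tMatrix P i j))) =
      (centralInv (ExtYangian P) * centralClear (ExtYangian P) 0) •
          ((if k = i.rev then ∑ p : Fin (N + 2 * m),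
              (paritySign (P.par i + P.par i * P.par j + P.par j * P.par p) * P.theta i *
                P.theta p) • (atV (tMatrix P p j) * atU (tMatrix P p.rev l)) else 0) -
            if l = j.rev then ∑ p : Fin (N + 2 * m),
              (paritySign (P.par i * P.par k + P.par j * P.par k + P.par i * P.par p) *
                P.theta j.rev * P.theta p.rev) •
                (atU (tMatrix P k p.rev) * atV (tMatrix P i p)) else 0) -
        (centralInv (ExtYangian P) * centralClear (ExtYangian P) (-P.kappa)) •
          (paritySign (P.par i * P.par j + P.par i * P.par k + P.par j * P.par k) •
            (atV (tMatrix P k j) * atU (tMatrix P i l) -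
              atU (tMatrix P k j) * atV (tMatrix P i l))) := by
  have h := congrArg (swapHom _) (rtt_relation P i j k l)
  simp only [mul_smul (centralClear _ _), mul_smul (centralInv _)] at h
  simp only [map_sub, swapHom_centralClear_smul, swapHom_centralInv_smul, smul_neg, neg_neg,
    neg_zero] at h
  simp only [map_sub, map_mul, map_sum, map_zero, swapHom_smul, swapHom_atU, swapHom_atV,
    leftSum, rightSum, apply_ite (swapHom (ExtYangian P))] at h
  rw [mul_comm (centralClear _ _), mul_smul, mul_smul, mul_smul]
  rw [h]
  abel

end

/-! ### Centrality of the scalar in `T(u - κ) T^t(u)` -/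

section

theorem smul_rearrange {k B : Type*} [CommRing k] [AddCommGroup B] [Module k B] [Module ℂ B]
    [SMulCommClass ℂ k B] {β σ ε : ℂ} {z w v : k} {x y S₁ S₂ a a' : B}
    (h : β • z • (x - σ • y) = β • (w • (S₁ - S₂) - v • ε • (a - a'))) :
    z • (σ • β • y - β • x) = v • (β • ε • a - β • ε • a') - w • (β • S₁ - β • S₂) := by
  have e : σ • β • y - β • x = -(β • (x - σ • y)) := by
    rw [smul_sub, smul_comm β σ]
    abel
  rw [e, smul_neg, ← smul_comm β z, h, ← smul_sub, ← smul_sub, ← smul_sub, ← smul_comm β v,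
    ← smul_comm β w, ← smul_sub, ← smul_neg, neg_sub]

variable {N m : ℕ} (P : OspParity N m)

/-- The exchange relation between `t_{ij}(u)` and the entries of `T^t(v)`. -/
theorem rtt_relation_tTransposed (i j q : Fin (N + 2 * m)) :
    (centralClear (ExtYangian P) (-P.kappa) * centralClear (ExtYangian P) 0) •
        (paritySign ((P.par i + P.par j) * (P.par i + P.par q)) •
            (atU (tMatrix P i j) * atV (tTransposed P q i)) -
          atV (tTransposed P q i) * atU (tMatrix P i j)) =
      (centralInv (ExtYangian P) * centralClear (ExtYangian P) (-P.kappa)) •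
          (atV (tTransposed P q i.rev) * atU (tMatrix P i.rev j) -
            (paritySign (P.par i + P.par i * P.par j + P.par i * P.par q) * P.theta j.rev *
              P.theta q) • (atU (tMatrix P i q.rev) * atV (tTransposed P j.rev i))) -
        (centralInv (ExtYangian P) * centralClear (ExtYangian P) 0) •
          (paritySign (P.par i) • ((∑ r, atV (tTransposed P q r) * atU (tMatrix P r j)) -
            if q = j then ∑ r, atU (tMatrix P i r) * atV (tTransposed P r i) else 0)) := by
  have h01 : ∀ a : ZMod 2, a = 0 ∨ a = 1 := by decide
  have atV_smul : ∀ (a : ℂ) (f : PowerSeries (ExtYangian P)), atV (a • f) = a • atV f := by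
    intro a f
    ext1 n
    rw [atV, atV, PowerSeries.coeff_smul, coeff_C, coeff_C]
    split_ifs <;> simp
  have hB : ∀ x y, atV (tTransposed P x y) =
      (paritySign (P.par x * P.par y + P.par y) * P.theta x * P.theta y) •
        atV (tMatrix P y.rev x.rev) := fun x y => by
    rw [tTransposed, Matrix.of_apply, atV_smul]
  set β : ℂ := paritySign (P.par q * P.par i + P.par i) * P.theta q * P.theta i with hβ
  -- Up to the scalar `β`, the entry `(q, i)` of `T^t` is `t_{i'q'}`. With first row index `i'` and
  -- second row index `i`, the first `Q`-sum is always present and becomes the product of `T^t(v)`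
  -- and `T(u)`; the second is present exactly when `q = j`.
  have h := congrArg (β • ·) (rtt_relation_swap P i.rev q.rev i j)
  have s0 : paritySign ((P.par i + P.par q) * (P.par i + P.par j)) =
    paritySign ((P.par i + P.par j) * (P.par i + P.par q)) := by rw [mul_comm]
  have ss := paritySign_mul_self ((P.par i + P.par j) * (P.par i + P.par q))
  have q1 : paritySign (P.par i) • ∑ r, atV (tTransposed P q r) * atU (tMatrix P r j) =
      β • ∑ p : Fin (N + 2 * m), (paritySign (P.par i + P.par i * P.par q + P.par q * P.par p) *
        P.theta i.rev * P.theta p) • (atV (tMatrix P p q.rev) * atU (tMatrix P p.rev j)) := by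
    rw [Finset.smul_sum, Finset.smul_sum, ← Equiv.sum_comp Fin.revPerm]
    refine Finset.sum_congr rfl fun r _ => ?_
    rw [Fin.revPerm_apply, hB, Fin.rev_rev, smul_mul_assoc, smul_smul, smul_smul, P.par_rev, hβ,
      P.theta_rev i, P.theta_rev r]
    congr 1
    have e1 : paritySign (P.par i) * paritySign (P.par q * P.par r + P.par r) *
        paritySign (P.par r) = paritySign (P.par q * P.par i + P.par i) *
        paritySign (P.par i + P.par i * P.par q + P.par q * P.par r) * paritySign (P.par i) := by
      simp only [← paritySign_add]
      congr 1
      generalize P.par i = a, P.par q = b, P.par r = c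
      decide +revert
    linear_combination (P.theta q * P.theta r) * e1 -
      (paritySign (P.par q * P.par i + P.par i) *
        paritySign (P.par i + P.par i * P.par q + P.par q * P.par r) * paritySign (P.par i) *
        P.theta q * P.theta r) * P.theta_mul_self i
  have q2 : paritySign (P.par i) •
      (if q = j then ∑ r, atU (tMatrix P i r) * atV (tTransposed P r i) else 0) =
      β • if j = q then ∑ p : Fin (N + 2 * m),
        (paritySign (P.par i * P.par i + P.par q * P.par i + P.par i * P.par p) *
          P.theta q * P.theta p.rev) •
            (atU (tMatrix P i p.rev) * atV (tMatrix P i.rev p)) else 0 := by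
    by_cases hqj : q = j
    · subst hqj
      rw [if_pos rfl, if_pos rfl, Finset.smul_sum, Finset.smul_sum, ← Equiv.sum_comp Fin.revPerm]
      refine Finset.sum_congr rfl fun r _ => ?_
      rw [Fin.revPerm_apply, hB, Fin.rev_rev, mul_smul_comm, smul_smul, smul_smul, P.par_rev, hβ]
      congr 1
      have e1 : paritySign (P.par i) * paritySign (P.par r * P.par i + P.par i) =
          paritySign (P.par q * P.par i + P.par i) *
          paritySign (P.par i * P.par i + P.par q * P.par i + P.par i * P.par r) := by
        simp only [← paritySign_add]
        congr 1
        generalize P.par i = a, P.par q = b, P.par r = c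
        decide +revert
      linear_combination (P.theta i * P.theta r.rev) * e1 -
        (paritySign (P.par q * P.par i + P.par i) *
          paritySign (P.par i * P.par i + P.par q * P.par i + P.par i * P.par r) *
          P.theta i * P.theta r.rev) * P.theta_mul_self q
    · rw [if_neg hqj, if_neg (Ne.symm hqj), smul_zero, smul_zero]
  have q3 : atV (tTransposed P q i.rev) * atU (tMatrix P i.rev j) =
      β • paritySign (P.par i) • (atV (tMatrix P i q.rev) * atU (tMatrix P i.rev j)) := by
    rw [hB, Fin.rev_rev, smul_mul_assoc, smul_smul, P.par_rev, hβ, P.theta_rev i]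
    congr 1
    ring
  have q4 : (paritySign (P.par i + P.par i * P.par j + P.par i * P.par q) * P.theta j.rev *
        P.theta q) • (atU (tMatrix P i q.rev) * atV (tTransposed P j.rev i)) =
      β • paritySign (P.par i) • (atU (tMatrix P i q.rev) * atV (tMatrix P i.rev j)) := by
    rw [hB, Fin.rev_rev, mul_smul_comm, smul_smul, smul_smul, P.par_rev, hβ]
    congr 1
    have e1 : paritySign (P.par i + P.par i * P.par j + P.par i * P.par q) *
        paritySign (P.par j * P.par i + P.par i) =
        paritySign (P.par q * P.par i + P.par i) * paritySign (P.par i) := by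
      simp only [← paritySign_add]
      congr 1
      generalize P.par i = a, P.par q = b, P.par j = c
      decide +revert
    linear_combination (P.theta i * P.theta q) * e1 +
      (paritySign (P.par i + P.par i * P.par j + P.par i * P.par q) *
        paritySign (P.par j * P.par i + P.par i) * P.theta i * P.theta q) *
          P.theta_mul_self j.rev
  have e5 : paritySign (P.par i * P.par q + P.par i * P.par i + P.par q * P.par i) =
      paritySign (P.par i) := by
    congr 1
    generalize P.par i = a, P.par q = b
    decide +revert
  rw [smul_sub (paritySign (P.par i)), q1, q2, q3, q4, hB]
  simp only [P.par_rev, Fin.rev_rev, if_true, s0, e5] at h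
  rw [← hβ, mul_smul_comm, smul_mul_assoc]
  exact smul_rearrange (k := TwoVarCenter (ExtYangian P))
    (B := PowerSeries (PowerSeries (ExtYangian P))) h

/-- The scalar in `T(u - κ) T^t(u) = c(u)` commutes with the generators. -/
theorem coeffsCommute_of_mul_tTransposed {c : PowerSeries (ExtYangian P)}
    (hc : (tMatrix P).map (seriesShift (-P.kappa)) * tTransposed P =
      Matrix.diagonal fun _ => c) (i j : Fin (N + 2 * m)) :
    CoeffsCommute (tMatrix P i j) c := by
  set z := centralClear (ExtYangian P) (-P.kappa) with hz
  set z' := centralClear (ExtYangian P) 0 with hz'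
  set W := centralInv (ExtYangian P) with hW
  set s := algebraMap ℂ (TwoVarCenter (ExtYangian P)) (paritySign (P.par i)) with hs
  have hab : ∀ k l, ∑ q, atV (seriesShift (-P.kappa) (tMatrix P k q)) * atV (tTransposed P q l) =
      if k = l then atV c else 0 := by
    intro k l
    have h := congrArg (atVHom _) (congrFun (congrFun hc k) l)
    rw [Matrix.mul_apply, map_sum, Matrix.diagonal_apply, apply_ite (atVHom _), map_zero] at h
    simp only [map_mul, Matrix.map_apply] at h
    exact h
  have key := commutator_of_crossing (k := TwoVarCenter (ExtYangian P)) (z := z) (z' := z')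
    (W := W) (s := s)
    (σ := fun q => algebraMap ℂ _ (paritySign ((P.par i + P.par j) * (P.par i + P.par q))))
    (e₁ := fun r => algebraMap ℂ _ (paritySign (P.par i + P.par i * P.par j + P.par j * P.par r) *
      P.theta i * P.theta r))
    (e₂ := fun r => algebraMap ℂ _
      (paritySign (P.par i + P.par i * P.par j + P.par i * P.par r) * P.theta j.rev *
        P.theta r.rev))
    (y := fun q => algebraMap ℂ _
      (paritySign (P.par i + P.par i * P.par j + P.par i * P.par q) * P.theta j.rev * P.theta q))
    (t := Matrix.of fun i j => atU (tMatrix P i j))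
    (a := Matrix.of fun i j => atV (seriesShift (-P.kappa) (tMatrix P i j)))
    (b := Matrix.of fun i j => atV (tTransposed P i j)) (c := atV c) i j hab ?_ ?_ ?_ ?_
  · set D := atU (tMatrix P i j) * atV c - atV c * atU (tMatrix P i j) with hD
    have key' : (z : PowerSeries (PowerSeries (ExtYangian P))) * z' * D = W * z' * s * D -
      W * z * (if i = i.rev then D else 0) := key
    set E : PowerSeries (PowerSeries (ExtYangian P)) :=
      z * z' - W * z' * s + W * z * (if i = i.rev then 1 else 0) with hE
    have hED : E * D = 0 := by
      rw [hE, add_mul, sub_mul, key', mul_assoc _ (ite _ _ _) D, ite_mul, one_mul, zero_mul]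
      abel
    -- The terms with `W` are divisible by `u⁻¹`, so only `z * z'` contributes, with leading
    -- coefficient `v⁻²`.
    have hcc : constantCoeff E = X * X := by
      have hW0 : constantCoeff (W : PowerSeries (PowerSeries (ExtYangian P))) = 0 := by
        rw [hW, centralInv]
        simp [invU]
      have h1 : constantCoeff (z : PowerSeries (PowerSeries (ExtYangian P))) = X :=
        constantCoeff_clearUVShift _
      have h2 : constantCoeff (z' : PowerSeries (PowerSeries (ExtYangian P))) = X :=
        constantCoeff_clearUVShift _
      simp only [hE, map_add, map_sub, map_mul, hW0, h1, h2, zero_mul, sub_zero, add_zero]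
    have hreg := isLeftRegular_of_constantCoeff (hcc ▸ isLeftRegular_X.mul isLeftRegular_X)
    rw [coeffsCommute_iff_atU_atV]
    exact sub_eq_zero.mp (isLeftRegular_iff_right_eq_zero_of_mul.mp hreg _ hED)
  · rw [← map_one (algebraMap ℂ (TwoVarCenter (ExtYangian P)))]
    congr 1
    have e1 : paritySign (P.par i + P.par i * P.par j + P.par j * P.par i.rev) =
        paritySign (P.par i) := by
      rw [P.par_rev]
      congr 1
      generalize P.par i = a, P.par j = b
      decide +revert
    rw [e1, mul_assoc, P.theta_mul_theta_rev, paritySign_mul_self]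
  · intro q
    simp only [P.par_rev]
  · intro q
    have h := rtt_relation_shift P i j i q
    have e1 : paritySign (P.par i * P.par j + P.par i * P.par i + P.par j * P.par i) =
        paritySign (P.par i) := by
      congr 1
      generalize P.par i = a, P.par j = b
      decide +revert
    have e2 : ∀ r, P.par i * P.par i + P.par j * P.par i + P.par i * P.par r =
        P.par i + P.par i * P.par j + P.par i * P.par r := by
      intro r
      generalize P.par i = a, P.par j = b, P.par r = c
      decide +revert
    simp only [e1, e2] at h
    rw [mul_smul (W * z') s]
    simp only [hs, algebraMap_smul, Matrix.of_apply]
    exact h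
  · intro q
    rw [mul_smul (W * z') s]
    simp only [hs, algebraMap_smul, Matrix.of_apply]
    exact rtt_relation_tTransposed P i j q

end

/-! ### Triangular factorization of the scalar product, and the block with `gl` relations -/

section

section Triangular

variable {S : Type*} [Ring S] {d : ℕ}

/-- If `F * (M * U)` is scalar, with `F`, `U` lower unitriangular, then the diagonal entries of
`M` are equal to that scalar. -/
theorem diag_eq_of_triangular_mul {F M U : Matrix (Fin d) (Fin d) S} {c : S}
    (hF1 : ∀ i, F i i = 1) (hF : ∀ i j, i < j → F i j = 0)
    (hU1 : ∀ i, U i i = 1) (hU : ∀ i j, i < j → U i j = 0)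
    (h : F * (M * U) = Matrix.diagonal fun _ => c) (i : Fin d) : M i i = c := by
  -- Forward substitution in the rows of `F`; only entries on and above the diagonal are determined.
  have upper : ∀ i j, i ≤ j → (M * U) i j = if i = j then c else 0 := by
    intro i
    induction i using WellFoundedLT.induction with
    | ind i ih =>
      intro j hij
      have e := congrFun (congrFun h i) j
      rw [Matrix.mul_apply, Finset.sum_eq_single i, hF1, one_mul, Matrix.diagonal_apply] at e
      · exact e
      · intro l _ hl
        rcases lt_or_gt_of_ne hl with hl | hl
        · rw [ih l hl j (hl.le.trans hij), if_neg (hl.trans_le hij).ne, mul_zero]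
        · rw [hF i l hl, zero_mul]
      · simp
  -- The same from the right, descending through the columns of `U`.
  have diag : ∀ j i, i ≤ j → M i j = if i = j then c else 0 := by
    intro j
    induction j using WellFoundedGT.induction with
    | ind j ih =>
      intro i hij
      rw [← upper i j hij, Matrix.mul_apply, Finset.sum_eq_single j, hU1, mul_one]
      · intro l _ hl
        rcases lt_or_gt_of_ne hl with hl | hl
        · rw [hU l j hl, mul_zero]
        · rw [ih l hl i (hij.trans hl.le), if_neg (hij.trans_lt hl).ne, zero_mul]
      · simp
  rw [diag i i le_rfl, if_pos rfl]

/-- The Gauss decompositions of `T` and of the reversal of `T'`, if `T * T'` is scalar. -/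
theorem IsGaussDecomposition.mul_rev_eq {T T' F E L U : Matrix (Fin d) (Fin d) S}
    {h h' : Fin d → S} {c : S} (hG : IsGaussDecomposition T F h E)
    (hG' : IsGaussDecomposition (T'.submatrix Fin.rev Fin.rev) L h' U)
    (hc : T * T' = Matrix.diagonal fun _ => c) (i : Fin d) : h i * h' i.rev = c := by
  have hT' : T' = L.submatrix Fin.rev Fin.rev * Matrix.diagonal (fun i => h' i.rev) *
      U.submatrix Fin.rev Fin.rev := by
    ext1 i j
    have e := congrFun (congrFun hG'.eq_mul i.rev) j.rev
    rw [Matrix.mul_apply, ← Equiv.sum_comp Fin.revPerm] at e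
    rw [Matrix.mul_apply]
    simpa [Matrix.mul_diagonal] using e
  -- Reversing indices makes `L` upper and `U` lower triangular. So the middle factor is upper
  -- triangular, with diagonal entries `h i * h' i.rev`.
  have key := diag_eq_of_triangular_mul (F := F) (M := Matrix.diagonal h *
    (E * (L.submatrix Fin.rev Fin.rev * Matrix.diagonal fun i => h' i.rev)))
    (U := U.submatrix Fin.rev Fin.rev) (c := c) hG.lower_diag hG.lower_zero
    (fun i => hG'.upper_diag i.rev)
    (fun i j hij => hG'.upper_zero _ _ (Fin.rev_lt_rev.mpr hij)) ?_ i
  · rw [Matrix.diagonal_mul, Matrix.mul_apply, Finset.sum_eq_single i, hG.upper_diag, one_mul,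
      Matrix.mul_diagonal, Matrix.submatrix_apply, hG'.lower_diag, one_mul] at key
    · exact key
    · intro l _ hl
      rcases lt_or_gt_of_ne hl with hl | hl
      · rw [hG.upper_zero i l hl, zero_mul]
      · rw [Matrix.mul_diagonal, Matrix.submatrix_apply,
          hG'.lower_zero _ _ (Fin.rev_lt_rev.mpr hl), zero_mul, mul_zero]
    · simp
  · rw [← hc, hT', hG.eq_mul]
    simp only [Matrix.mul_assoc]

/-- The Gauss decomposition of a top left block. -/
theorem IsGaussDecomposition.castLE {T F E : Matrix (Fin d) (Fin d) S} {h : Fin d → S}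
    (hG : IsGaussDecomposition T F h E) {e : ℕ} (he : e ≤ d) :
    IsGaussDecomposition (T.submatrix (Fin.castLE he) (Fin.castLE he))
      (F.submatrix (Fin.castLE he) (Fin.castLE he)) (fun i => h (Fin.castLE he i))
      (E.submatrix (Fin.castLE he) (Fin.castLE he)) where
  lower_diag i := hG.lower_diag _
  lower_zero i j hij := hG.lower_zero _ _ hij
  upper_diag i := hG.upper_diag _
  upper_zero i j hij := hG.upper_zero _ _ hij
  eq_mul := by
    obtain ⟨f, rfl⟩ := Nat.exists_eq_add_of_le he
    ext1 i j
    have key := congrFun (congrFun hG.eq_mul (Fin.castLE he i)) (Fin.castLE he j)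
    rw [Matrix.mul_apply, Fin.sum_univ_add, Finset.sum_eq_zero (s := Finset.univ (α := Fin f)),
      add_zero] at key
    · rw [Matrix.mul_apply]
      simp only [Matrix.mul_diagonal] at key ⊢
      exact key
    · intro k _
      have hlt : Fin.castLE he i < Fin.natAdd e k := by
        simp only [Fin.lt_def, Fin.val_castLE, Fin.val_natAdd]
        omega
      rw [Matrix.mul_diagonal, hG.lower_zero _ _ hlt, zero_mul, zero_mul]

end Triangular

variable {N m : ℕ} (P : OspParity N m)

/-- The extended Yangian is generated by the coefficients of the matrix entries. -/
theorem mem_center_of_commute {x : ExtYangian P}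
    (hx : ∀ i j r, Commute (coeff r (tMatrix P i j)) x) :
    x ∈ Subalgebra.center ℂ (ExtYangian P) := by
  rw [Subalgebra.mem_center_iff]
  intro b
  obtain ⟨y, rfl⟩ := RingQuot.mkAlgHom_surjective ℂ (RttRel P) b
  induction y using FreeAlgebra.induction with
  | grade0 a =>
    rw [AlgHom.commutes]
    exact Algebra.commutes a x
  | grade1 g =>
    obtain ⟨i, j, r⟩ := g
    have h := (hx i j (r + 1)).eq
    simp only [tMatrix, Matrix.of_apply, coeff_mk, tGen] at h
    exact h
  | mul a b ha hb =>
    rw [map_mul]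
    exact (Commute.mul_left ha hb : Commute _ _)
  | add a b ha hb =>
    rw [map_add]
    exact (Commute.add_left ha hb : Commute _ _)

/-- The supertransposed matrix, with rows and columns in the reversed order. -/
theorem tTransposed_rev_constantCoeff (i j : Fin (N + 2 * m)) :
    constantCoeff ((tTransposed P).submatrix Fin.rev Fin.rev i j) = if i = j then 1 else 0 := by
  have h : constantCoeff ((tTransposed P).submatrix Fin.rev Fin.rev i j) =
      (paritySign (P.par i * P.par j + P.par j) * P.theta i.rev * P.theta j.rev) •
        constantCoeff (tMatrix P j i) := by
    simp only [Matrix.submatrix_apply, tTransposed, Matrix.of_apply, Fin.rev_rev, P.par_rev]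
    rw [← coeff_zero_eq_constantCoeff_apply, PowerSeries.coeff_smul,
      coeff_zero_eq_constantCoeff_apply]
  rw [h, tMatrix_constantCoeff]
  by_cases hij : i = j
  · subst hij
    have e : P.par i * P.par i + P.par i = 0 := by
      generalize P.par i = a
      decide +revert
    rw [e, paritySign_zero, one_mul, P.theta_mul_self, one_smul]
  · rw [if_neg hij, if_neg (Ne.symm hij), smul_zero]

/-- The diagonal entries of the Gauss decomposition of the reversed supertransposed matrix. -/
def transposedSeries : Fin (N + 2 * m) → PowerSeries (ExtYangian P) :=
  (exists_gaussDecomposition _ (tTransposed_rev_constantCoeff P)).choose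

theorem transposedSeries_spec : ∃ L U, IsGaussDecomposition
    ((tTransposed P).submatrix Fin.rev Fin.rev) L (transposedSeries P) U :=
  (exists_gaussDecomposition _ (tTransposed_rev_constantCoeff P)).choose_spec

theorem constantCoeff_hSeries (i : Fin (N + 2 * m)) : constantCoeff (hSeries P i) = 1 := by
  obtain ⟨F, E, hG⟩ := hSeries_spec P
  exact hG.constantCoeff_diag (tMatrix_constantCoeff P) i

theorem constantCoeff_transposedSeries (i : Fin (N + 2 * m)) :
    constantCoeff (transposedSeries P i) = 1 := by
  obtain ⟨F, E, hG⟩ := transposedSeries_spec P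
  exact hG.constantCoeff_diag (tTransposed_rev_constantCoeff P) i

/-- The scalar `T(u - κ) T^t(u)`, through the diagonal entries of the Gauss decompositions. -/
theorem shift_hSeries_mul_transposedSeries {c : PowerSeries (ExtYangian P)}
    (hc : (tMatrix P).map (seriesShift (-P.kappa)) * tTransposed P =
      Matrix.diagonal fun _ => c) (i : Fin (N + 2 * m)) :
    seriesShift (-P.kappa) (hSeries P i.rev) * transposedSeries P i = c := by
  obtain ⟨F, E, hG⟩ := hSeries_spec P
  obtain ⟨L, U, hG'⟩ := transposedSeries_spec P
  have h := (hG.map (shiftHom _ (-P.kappa))).mul_rev_eq hG' hc i.rev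
  rw [Fin.rev_rev] at h
  exact h

theorem isCentralSeries_of_mul_tTransposed (i : Fin (N + 2 * m)) {c : PowerSeries (ExtYangian P)}
    (hc : (tMatrix P).map (seriesShift (-P.kappa)) * tTransposed P =
      Matrix.diagonal fun _ => c) : IsCentralSeries P c where
  coeff_zero := by
    rw [← shift_hSeries_mul_transposedSeries P hc i, coeff_zero_eq_constantCoeff_apply, map_mul,
      constantCoeff_seriesShift, constantCoeff_hSeries, constantCoeff_transposedSeries, one_mul]
  mem_center s := mem_center_of_commute P fun i j r =>
    coeffsCommute_of_mul_tTransposed P hc i j r s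
  mul_eq := hc

/-- The central series exists as soon as the space is not zero. -/
theorem exists_isCentralSeries (i : Fin (N + 2 * m)) : ∃ c, IsCentralSeries P c := by
  obtain ⟨c, hc⟩ := exists_mul_tTransposed P
  exact ⟨c, isCentralSeries_of_mul_tTransposed P i hc⟩

theorem IsCentralSeries.coeffsCommute {P : OspParity N m} {c : PowerSeries (ExtYangian P)}
    (hc : IsCentralSeries P c) (f : PowerSeries (ExtYangian P)) : CoeffsCommute f c :=
  fun _ s => (Subalgebra.mem_center_iff.mp (hc.mem_center s) _ : _)

/-- Centrality of `c` allows the two factors to be exchanged, which puts the product of ratios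
first. -/
theorem IsCentralSeries.eq_mul {P : OspParity N m} {c : PowerSeries (ExtYangian P)}
    (hc : IsCentralSeries P c) (i : Fin (N + 2 * m)) :
    c = transposedSeries P i * seriesShift (-P.kappa) (hSeries P i.rev) := by
  have h := shift_hSeries_mul_transposedSeries P hc.mul_eq i
  set a := seriesShift (-P.kappa) (hSeries P i.rev) with ha
  have hu : IsUnit a := isUnit_of_constantCoeff_eq_one
    (by rw [ha, constantCoeff_seriesShift, constantCoeff_hSeries])
  have hcomm := (hc.coeffsCommute a).commute.eq
  rw [← h] at hcomm ⊢
  have := hu.mul_left_cancel (by rw [hcomm, mul_assoc] : a * (a * transposedSeries P i) =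
    a * (transposedSeries P i * a))
  exact this

/-- The size `⌈N/2⌉ + m` of the block of the generator matrix considered below. -/
abbrev blockSize (N m : ℕ) : ℕ := (N + 1) / 2 + m

theorem blockSize_le (N m : ℕ) : blockSize N m ≤ N + 2 * m := by
  unfold blockSize
  omega

/-- The embedding of the indices of the block. -/
abbrev blockIndex (N m : ℕ) : Fin (blockSize N m) → Fin (N + 2 * m) :=
  Fin.castLE (blockSize_le N m)

/-- Two indices of the block add up to a mirror pair only if both are the middle index. -/
theorem blockIndex_rev_ne {i k : Fin (blockSize N m)}
    (h : i ≠ k ∨ (blockIndex N m i).rev ≠ blockIndex N m i) :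
    blockIndex N m k ≠ (blockIndex N m i).rev := by
  intro hk
  rcases h with h | h
  · have h1 := congrArg Fin.val hk
    have h2 : (i : ℕ) ≠ k := fun e => h (Fin.ext e)
    have hi := i.2
    have hk := k.2
    simp only [blockSize] at hi hk
    simp only [Fin.val_rev, Fin.val_castLE] at h1
    omega
  · by_cases e : i = k
    · exact h (by rw [← hk, e])
    · have h1 := congrArg Fin.val hk
      have h2 : (i : ℕ) ≠ k := fun e' => e (Fin.ext e')
      have hi := i.2
      have hk := k.2
      simp only [blockSize] at hi hk
      simp only [Fin.val_rev, Fin.val_castLE] at h1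
      omega

/-- Only the middle index of the block may fail to be good. -/
theorem blockIndex_good {i : Fin (blockSize N m)} (hi : (i : ℕ) + 1 < blockSize N m) :
    (blockIndex N m i).rev ≠ blockIndex N m i := by
  intro h
  have h1 := congrArg Fin.val h
  simp only [blockSize] at hi
  simp only [Fin.val_rev, Fin.val_castLE] at h1
  omega

theorem centralClear_smul_cancel {A : Type*} [Ring A] [Algebra ℂ A] (a : ℂ)
    {F G : PowerSeries (PowerSeries A)} (h : centralClear A a • F = centralClear A a • G) :
    F = G :=
  sub_eq_zero.mp (centralClear_smul_eq_zero a _ ((smul_sub _ _ _).trans (sub_eq_zero.mpr h)))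

theorem glRel_of_smul_eq {A ι : Type*} [Ring A] [Algebra ℂ A] {p : ι → ZMod 2}
    {T : ι → ι → PowerSeries A} {i j k l : ι}
    (h : centralClear A 0 • (atU (T i j) * atV (T k l) -
        paritySign ((p i + p j) * (p k + p l)) • (atV (T k l) * atU (T i j))) =
      centralInv A • (paritySign (p i * p j + p i * p k + p j * p k) •
        (atU (T k j) * atV (T i l) - atV (T k j) * atU (T i l)))) : GLRel p T i j k l := by
  unfold GLRel ExchangeRel
  rw [mul_smul, scalarSign_smul (k := TwoVarCenter A), scalarSign_smul (k := TwoVarCenter A)]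
  exact h

/-- Both `Q`-sums are absent for these indices, and the common factor `u - v - κ` cancels. -/
theorem block_isPartialRTT : IsPartialRTT (fun i => P.par (blockIndex N m i))
    (fun i => (blockIndex N m i).rev ≠ blockIndex N m i)
    ((tMatrix P).submatrix (blockIndex N m) (blockIndex N m)) where
  constantCoeff_eq i j := by
    rw [Matrix.submatrix_apply, tMatrix_constantCoeff]
    simp [Fin.ext_iff]
  rel i j k l hik hjl := by
    have h := rtt_relation P (blockIndex N m i) (blockIndex N m j) (blockIndex N m k)
      (blockIndex N m l)
    rw [if_neg (blockIndex_rev_ne hik), if_neg (blockIndex_rev_ne hjl), sub_zero, smul_zero,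
      sub_zero, mul_comm (centralClear _ 0), mul_comm (centralInv _), mul_smul, mul_smul] at h
    have h' := centralClear_smul_cancel _ h
    exact glRel_of_smul_eq h'

/-- On the mirror images of the block, `θ` is the parity sign. The middle index, if there is one,
causes no conflict, since its parity is even. -/
theorem block_superTranspose :
    superTranspose (fun i => P.par (blockIndex N m i))
      ((tMatrix P).submatrix (blockIndex N m) (blockIndex N m)) =
    ((tTransposed P).submatrix Fin.rev Fin.rev).submatrix (blockIndex N m) (blockIndex N m) := by
  have hθ : ∀ i : Fin (blockSize N m), P.theta (blockIndex N m i).rev =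
      paritySign (P.par (blockIndex N m i)) := by
    intro i
    rw [P.theta_rev, OspParity.theta, if_pos (by simp), mul_one]
  ext1 i j
  simp only [superTranspose, tTransposed, Matrix.of_apply, Matrix.submatrix_apply, Fin.rev_rev,
    P.par_rev, hθ, scalarSign_complex]
  rw [← paritySign_add, ← paritySign_add]
  congr 2
  generalize P.par (blockIndex N m i) = a, P.par (blockIndex N m j) = b
  decide +revert

end

/-! ### Commutativity of the diagonal series -/

section SelfCommuting

variable {A : Type*} [Ring A] [Algebra ℂ A] {S : Subalgebra ℂ A} {f : PowerSeries A}

/-- The coefficients of a shifted series, up to terms of lower order. -/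
theorem coeff_seriesShift_sub_mem (a : ℂ) {n : ℕ} (h : ∀ r < n, coeff r f ∈ S) :
    coeff n (seriesShift a f) - coeff n f ∈ S := by
  rw [coeff_seriesShift a f le_rfl, Finset.sum_range_succ, shiftCoeff_self, one_smul,
    add_sub_cancel_right]
  exact S.sum_mem fun r hr => S.smul_mem (h r (Finset.mem_range.mp hr)) _

/-- A series is determined by a product of two of its shifts. -/
theorem coeffsIn_of_shift_mul_shift {a b : ℂ} (h1 : constantCoeff f = 1)
    (h : CoeffsIn S (seriesShift a f * seriesShift b f)) : CoeffsIn S f := by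
  intro n
  induction n using Nat.strong_induction_on with
  | _ n ih =>
    cases n with
    | zero =>
      rw [coeff_zero_eq_constantCoeff_apply, h1]
      exact S.one_mem
    | succ k =>
      have low : ∀ (x : ℂ), ∀ r < k + 1, coeff r (seriesShift x f) ∈ S := fun x r hr => by
        have := S.add_mem (coeff_seriesShift_sub_mem x fun s hs => ih s (hs.trans hr)) (ih r hr)
        rwa [sub_add_cancel] at this
      have hk := h (k + 1)
      rw [coeff_mul, Finset.Nat.sum_antidiagonal_eq_sum_range_succ_mk, Finset.sum_range_succ,
        Finset.sum_range_succ'] at hk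
      simp only [Nat.sub_self, Nat.sub_zero, coeff_zero_eq_constantCoeff_apply,
        constantCoeff_seriesShift, h1, one_mul, mul_one] at hk
      have hmid : ∑ x ∈ Finset.range k, coeff (x + 1) (seriesShift a f) *
          coeff (k + 1 - (x + 1)) (seriesShift b f) ∈ S := S.sum_mem fun x hx => by
        have := Finset.mem_range.mp hx
        exact S.mul_mem (low a _ (by omega)) (low b _ (by omega))
      -- The coefficient of order `k + 1` of the product is twice that of `f`, plus terms from lower
      -- coefficients of `f`, already known to lie in `S`.
      have h2 := S.smul_mem (S.sub_mem (S.sub_mem (S.sub_mem hk hmid)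
        (coeff_seriesShift_sub_mem a ih)) (coeff_seriesShift_sub_mem b ih)) (1 / 2 : ℂ)
      convert h2 using 1
      module

end SelfCommuting

namespace OspParity

variable {N m : ℕ} (P : OspParity N m)

theorem signSum_succ (i : Fin (N + 2 * m)) :
    P.signSum (i + 1) = P.signSum i + paritySign (P.par i) := by
  have h : paritySign (P.par i) = ∑ k, if k = i then paritySign (P.par k) else 0 := by simp
  rw [signSum, signSum, h, ← Finset.sum_add_distrib]
  refine Finset.sum_congr rfl fun k _ => ?_
  by_cases hk : k = i
  · subst hk; simp
  · have : (k : ℕ) ≠ i := fun e => hk (Fin.ext e)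
    have e : ((k : ℕ) < i + 1) = ((k : ℕ) < i) := by
      apply propext
      omega
    rw [if_neg hk, add_zero]
    simp only [e]

theorem sum_paritySign : ∑ k, paritySign (P.par k) = (N : ℂ) - 2 * m := by
  have h01 : ∀ a : ZMod 2, a = 0 ∨ a = 1 := by decide
  have h : ∀ k, paritySign (P.par k) = 1 - 2 * (if P.par k = 1 then 1 else 0) := by
    intro k
    rcases h01 (P.par k) with h | h <;> simp [paritySign, h]
    norm_num
  simp only [h, Finset.sum_sub_distrib, ← Finset.mul_sum, Finset.sum_boole, P.card_odd]
  simp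
  ring

/-- By the symmetry of the parities the last `s` signs have the same sum as the first `s`, so the
two partial sums add up to the superdimension. -/
theorem signSum_add_signSum_sub {s t : ℕ} (hs : s + t = N + 2 * m) :
    P.signSum s + P.signSum t = (N : ℂ) - 2 * m := by
  rw [← P.sum_paritySign, signSum, signSum, ← Equiv.sum_comp Fin.revPerm (fun k =>
    if (k : ℕ) < t then paritySign (P.par k) else 0), ← Finset.sum_add_distrib]
  refine Finset.sum_congr rfl fun k _ => ?_
  have hk := k.2
  simp only [Fin.revPerm_apply, P.par_rev, Fin.val_rev]
  by_cases h : (k : ℕ) < s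
  · rw [if_pos h, if_neg (by omega), add_zero]
  · rw [if_neg h, if_pos (by omega), zero_add]

end OspParity

variable {N m : ℕ} (P : OspParity N m)

theorem partialSignSum_block {s : ℕ} (hs : s ≤ blockSize N m) :
    partialSignSum (fun i => P.par (blockIndex N m i)) s = P.signSum s := by
  have key : ∀ {d e : ℕ} (he : e ≤ d) (hs : s ≤ e) (p : Fin d → ZMod 2),
      partialSignSum (fun i => p (Fin.castLE he i)) s =
        ∑ k : Fin d, if (k : ℕ) < s then paritySign (p k) else 0 := by
    intro d e he hs p
    obtain ⟨f, rfl⟩ := Nat.exists_eq_add_of_le he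
    rw [Fin.sum_univ_add, Finset.sum_eq_zero (s := Finset.univ (α := Fin f)), add_zero]
    · rfl
    · intro k _
      rw [if_neg]
      simp only [Fin.val_natAdd]
      omega
  exact key _ hs _

theorem shiftRatioProd_block (i : Fin (blockSize N m)) :
    shiftRatioProd (fun i => P.par (blockIndex N m i))
      (fun i => hSeries P (blockIndex N m i)) i i.2.le =
    hRatioProd P i (i.2.le.trans (blockSize_le N m)) := by
  unfold shiftRatioProd hRatioProd
  congr 1
  refine List.map_congr_left fun k _ => ?_
  have hk := k.2
  have hi := i.2
  unfold shiftRatio hRatio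
  simp only [Fin.val_castLE]
  rw [partialSignSum_block P (by omega), partialSignSum_block P (by omega)]
  rfl

theorem block_commute (i j : Fin (blockSize N m))
    (hij : i ≠ j ∨ (blockIndex N m i).rev ≠ blockIndex N m i) :
    CoeffsCommute (hSeries P (blockIndex N m i)) (hSeries P (blockIndex N m j)) := by
  obtain ⟨F, E, hG⟩ := hSeries_spec P
  exact (block_isPartialRTT P).diag_commute (fun _ => blockIndex_good)
    (hG.castLE (blockSize_le N m)) i j hij

theorem transposedSeries_block (i : Fin (blockSize N m)) :
    transposedSeries P (blockIndex N m i) =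
      hRatioProd P i (i.2.le.trans (blockSize_le N m)) *
        seriesShift (-P.signSum i) (hSeries P (blockIndex N m i)) := by
  obtain ⟨F, E, hG⟩ := hSeries_spec P
  obtain ⟨L, U, hG'⟩ := transposedSeries_spec P
  have hG'' := hG'.castLE (blockSize_le N m)
  rw [← block_superTranspose] at hG''
  rw [(block_isPartialRTT P).superTranspose_diag (fun _ => blockIndex_good)
    (hG.castLE (blockSize_le N m)) hG'' i, partialSignSum_block P i.2.le, shiftRatioProd_block]

/-- The common source of all three formulas, valid for every index of the block; they arise from its
last index. -/
theorem IsCentralSeries.eq_hRatioProd_mul {P : OspParity N m} {c : PowerSeries (ExtYangian P)}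
    (hc : IsCentralSeries P c) (i : Fin (blockSize N m)) :
    c = hRatioProd P i (i.2.le.trans (blockSize_le N m)) *
      (seriesShift (-P.signSum i) (hSeries P (blockIndex N m i)) *
        seriesShift (-P.kappa) (hSeries P (blockIndex N m i).rev)) := by
  rw [← mul_assoc, ← transposedSeries_block]
  exact hc.eq_mul _

/-- The product of ratios commutes with everything that commutes with the series in it. -/
theorem coeffsCommute_hRatioProd {f : PowerSeries (ExtYangian P)} (s : ℕ) (hs : s ≤ N + 2 * m)
    (h : ∀ i : Fin s, CoeffsCommute f (hSeries P (Fin.castLE hs i))) :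
    CoeffsCommute f (hRatioProd P s hs) := by
  refine CoeffsCommute.list_prod_right fun g hg => ?_
  obtain ⟨i, -, rfl⟩ := List.mem_map.mp hg
  exact ((h i).shift_right _).mul_right (((h i).shift_right _).inverse_right
    (by rw [constantCoeff_seriesShift, constantCoeff_hSeries]))

theorem constantCoeff_hRatioProd_block (i : Fin (blockSize N m)) :
    constantCoeff (hRatioProd P i (i.2.le.trans (blockSize_le N m))) = 1 := by
  have h := constantCoeff_transposedSeries P (blockIndex N m i)
  rwa [transposedSeries_block, map_mul, constantCoeff_seriesShift, constantCoeff_hSeries,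
    mul_one] at h

/-- The middle series, for odd `N`, commutes with itself. -/
theorem block_commute_self (i : Fin (blockSize N m))
    (hi : (blockIndex N m i).rev = blockIndex N m i) :
    CoeffsCommute (hSeries P (blockIndex N m i)) (hSeries P (blockIndex N m i)) := by
  obtain ⟨c, hc⟩ := exists_isCentralSeries P (blockIndex N m i)
  have e := hc.eq_hRatioProd_mul i
  rw [hi] at e
  set f := hSeries P (blockIndex N m i) with hf
  set R := hRatioProd P i (i.2.le.trans (blockSize_le N m)) with hR
  have hR1 : constantCoeff R = 1 := constantCoeff_hRatioProd_block P i
  have hfR : CoeffsCommute f R := coeffsCommute_hRatioProd P _ _ fun k =>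
    block_commute P i (Fin.castLE i.2.le k) (Or.inl fun hk => by
      have := congrArg Fin.val hk
      simp only [Fin.val_castLE] at this
      omega)
  -- The relations of the block say nothing about the middle series against itself. Solving the
  -- formula for `c` expresses a product of two of its shifts through series that commute with it.
  have hG : seriesShift (-P.signSum i) f * seriesShift (-P.kappa) f = Ring.inverse R * c := by
    rw [e, ← mul_assoc (Ring.inverse R), Ring.inverse_mul_cancel R
      (isUnit_of_constantCoeff_eq_one hR1), one_mul]
  have hfG := (hfR.inverse_right hR1).mul_right (hc.coeffsCommute f)
  rw [← hG] at hfG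
  exact coeffsCommute_iff.mpr fun r =>
    coeffsIn_of_shift_mul_shift (constantCoeff_hSeries P _) (coeffsCommute_iff.mp hfG r)

theorem block_commute_all (i j : Fin (blockSize N m)) :
    CoeffsCommute (hSeries P (blockIndex N m i)) (hSeries P (blockIndex N m j)) := by
  by_cases hij : i ≠ j ∨ (blockIndex N m i).rev ≠ blockIndex N m i
  · exact block_commute P i j hij
  · push Not at hij
    rw [← hij.1]
    exact block_commute_self P i hij.2

/-- Whatever commutes with the series in the block also commutes with their mirror images. -/
theorem coeffsCommute_hSeries_rev {f : PowerSeries (ExtYangian P)}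
    (hf : ∀ k, CoeffsCommute f (hSeries P (blockIndex N m k))) (i : Fin (blockSize N m)) :
    CoeffsCommute f (hSeries P (blockIndex N m i).rev) := by
  obtain ⟨c, hc⟩ := exists_isCentralSeries P (blockIndex N m i)
  have e := hc.eq_mul (blockIndex N m i)
  set R := transposedSeries P (blockIndex N m i) with hR
  have hR1 : constantCoeff R = 1 := constantCoeff_transposedSeries P _
  have hfR : CoeffsCommute f R := by
    rw [hR, transposedSeries_block]
    exact (coeffsCommute_hRatioProd P _ _ fun k => hf (Fin.castLE i.2.le k)).mul_right
      ((hf i).shift_right _)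
  -- The mirror series is expressed through the block and the central series.
  have hG : seriesShift (-P.kappa) (hSeries P (blockIndex N m i).rev) = Ring.inverse R * c := by
    rw [e, ← mul_assoc (Ring.inverse R), Ring.inverse_mul_cancel R
      (isUnit_of_constantCoeff_eq_one hR1), one_mul]
  have hfG := (hfR.inverse_right hR1).mul_right (hc.coeffsCommute f)
  rw [← hG] at hfG
  have := hfG.shift_right P.kappa
  rwa [seriesShift_seriesShift, add_neg_cancel, seriesShift_zero] at this

theorem hSeries_commute (i j : Fin (N + 2 * m)) (hi : (i : ℕ) ≤ N / 2 + m)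
    (hj : (j : ℕ) ≤ N / 2 + m) : CoeffsCommute (hSeries P i) (hSeries P j) := by
  have cases : ∀ i : Fin (N + 2 * m), (i : ℕ) ≤ N / 2 + m →
      (∃ k, i = blockIndex N m k) ∨ ∃ k, i = (blockIndex N m k).rev := by
    intro i hi
    have h := i.2
    by_cases hb : (i : ℕ) < blockSize N m
    · exact Or.inl ⟨⟨i, hb⟩, rfl⟩
    · refine Or.inr ⟨⟨i.rev, ?_⟩, Fin.ext ?_⟩
      · simp only [blockSize, Fin.val_rev] at hb ⊢
        omega
      · simp only [Fin.val_rev, Fin.val_castLE]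
        omega
  have left : ∀ (i : Fin (N + 2 * m)) k, (i : ℕ) ≤ N / 2 + m →
      CoeffsCommute (hSeries P i) (hSeries P (blockIndex N m k)) := by
    intro i k hi
    obtain ⟨l, rfl⟩ | ⟨l, rfl⟩ := cases i hi
    · exact block_commute_all P l k
    · exact (coeffsCommute_hSeries_rev P (fun l' => block_commute_all P k l') l).symm
  obtain ⟨k, rfl⟩ | ⟨k, rfl⟩ := cases j hj
  · exact left i k hi
  · exact coeffsCommute_hSeries_rev P (fun k => left i k hi) k

/-! ### Values of the shifts, and the three formulas -/

/-- The values of the shifts for even `N`. -/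
theorem signSum_even {n m : ℕ} (P : OspParity (2 * n) m) (i : Fin (2 * n + 2 * m))
    (hi : (i : ℕ) + 1 = n + m) : -P.signSum i = -(n : ℂ) + m + paritySign (P.par i) := by
  have h1 := P.signSum_succ i
  have h2 := P.signSum_add_signSum_sub (s := n + m) (t := n + m) (by omega)
  rw [hi] at h1
  push_cast at h2
  -- The first half of the basis carries half of the superdimension, `n - m`; removing the sign of
  -- index `i` gives the partial sum before it.
  linear_combination h1 - h2 / 2

theorem signSum_odd {n m : ℕ} (P : OspParity (2 * n + 1) m) :
    -P.signSum (n + m) = -(n : ℂ) + m := by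
  have h1 := P.signSum_succ ⟨n + m, by omega⟩
  have h2 := P.signSum_add_signSum_sub (s := n + m) (t := n + m + 1) (by omega)
  rw [P.par_eq_zero_of_rev_eq (by ext; simp only [Fin.val_rev]; omega), paritySign_zero] at h1
  push_cast at h2
  simp only at h1
  linear_combination h1 / 2 - h2 / 2

theorem kappa_even {n m : ℕ} (P : OspParity (2 * n) m) : -P.kappa = -(n : ℂ) + m + 1 := by
  rw [OspParity.kappa]
  push_cast
  ring

theorem kappa_odd {n m : ℕ} (P : OspParity (2 * n + 1) m) :
    -P.kappa = -(n : ℂ) + m + 1 / 2 := by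
  rw [OspParity.kappa]
  push_cast
  ring

/-- The central series for even `N`, before the sign is made explicit. -/
theorem exists_centralSeries_even {n m : ℕ} (P : OspParity (2 * n) m) (i : Fin (2 * n + 2 * m))
    (hi : (i : ℕ) + 1 = n + m) : ∃ c : PowerSeries (ExtYangian P), IsCentralSeries P c ∧
      c = hRatioProd P i i.2.le *
        (seriesShift (-(n : ℂ) + m + paritySign (P.par i)) (hSeries P i) *
          seriesShift (-(n : ℂ) + m + 1) (hSeries P i.rev)) := by
  have hM : (i : ℕ) < blockSize (2 * n) m := by
    unfold blockSize
    omega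
  obtain ⟨c, hc⟩ := exists_isCentralSeries P i
  refine ⟨c, hc, ?_⟩
  have h := hc.eq_hRatioProd_mul ⟨i, hM⟩
  rw [kappa_even] at h
  simp only [signSum_even P i hi] at h
  exact h

theorem lemma4p4 :
    -- `N = 2n`, `v_{n+m}` even
    (∀ (n m : ℕ) (hnm : 1 ≤ n + m) (P : OspParity (2 * n) m),
      P.par ⟨n + m - 1, by omega⟩ = 0 →
      ∃ c : PowerSeries (ExtYangian P), IsCentralSeries P c ∧
        c = hRatioProd P (n + m - 1) (by omega) *
          (seriesShift (-(n : ℂ) + m + 1) (hSeries P ⟨n + m - 1, by omega⟩) *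
            seriesShift (-(n : ℂ) + m + 1) (hSeries P ⟨n + m, by omega⟩))) ∧
    -- `N = 2n`, `v_{n+m}` odd
    (∀ (n m : ℕ) (hnm : 1 ≤ n + m) (P : OspParity (2 * n) m),
      P.par ⟨n + m - 1, by omega⟩ = 1 →
      ∃ c : PowerSeries (ExtYangian P), IsCentralSeries P c ∧
        c = hRatioProd P (n + m - 1) (by omega) *
          (seriesShift (-(n : ℂ) + m - 1) (hSeries P ⟨n + m - 1, by omega⟩) *
            seriesShift (-(n : ℂ) + m + 1) (hSeries P ⟨n + m, by omega⟩))) ∧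
    -- `N = 2n + 1`
    (∀ (n m : ℕ) (P : OspParity (2 * n + 1) m),
      ∃ c : PowerSeries (ExtYangian P), IsCentralSeries P c ∧
        c = hRatioProd P (n + m) (by omega) *
          (seriesShift (-(n : ℂ) + m + 1 / 2) (hSeries P ⟨n + m, by omega⟩) *
            seriesShift (-(n : ℂ) + m) (hSeries P ⟨n + m, by omega⟩))) ∧
    -- the series in these formulas commute with each other, so the order of factors is immaterial
    (∀ (N m : ℕ) (P : OspParity N m) (i j : Fin (N + 2 * m)),
      (i : ℕ) ≤ N / 2 + m → (j : ℕ) ≤ N / 2 + m →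
      ∀ r s : ℕ, Commute (coeff r (hSeries P i)) (coeff s (hSeries P j))) := by
  have rev : ∀ {n m : ℕ} (hnm : 1 ≤ n + m),
      (⟨n + m - 1, by omega⟩ : Fin (2 * n + 2 * m)).rev = ⟨n + m, by omega⟩ := by
    intro n m hnm
    ext
    simp only [Fin.val_rev]
    omega
  refine ⟨fun n m hnm P hP => ?_, fun n m hnm P hP => ?_, fun n m P => ?_,
    fun N m P i j hi hj => hSeries_commute P i j hi hj⟩
  · have h := exists_centralSeries_even P ⟨n + m - 1, by omega⟩ (Nat.sub_add_cancel hnm)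
    rw [rev hnm, hP, paritySign_zero] at h
    exact h
  · have h := exists_centralSeries_even P ⟨n + m - 1, by omega⟩ (Nat.sub_add_cancel hnm)
    rw [rev hnm, hP, show paritySign 1 = -1 from if_neg one_ne_zero, ← sub_eq_add_neg] at h
    exact h
  · have hM : n + m < blockSize (2 * n + 1) m := by
      unfold blockSize
      omega
    obtain ⟨c, hc⟩ := exists_isCentralSeries P ⟨n + m, by omega⟩
    refine ⟨c, hc, ?_⟩
    have h := hc.eq_hRatioProd_mul ⟨n + m, hM⟩
    have hrev : (blockIndex (2 * n + 1) m ⟨n + m, hM⟩).rev = blockIndex _ m ⟨n + m, hM⟩ := by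
      ext
      simp only [Fin.val_rev, Fin.val_castLE]
      omega
    -- The general formula has the shift by `-κ` last, so the two factors are exchanged using that
    -- the middle series commutes with itself.
    rw [hrev, kappa_odd, ((((block_commute_self P _ hrev).shift_right _).symm.shift_right
      _).commute.eq : seriesShift (-P.signSum (n + m)) (hSeries P (blockIndex _ m ⟨n + m, hM⟩)) *
        seriesShift (-(n : ℂ) + m + 1 / 2) (hSeries P (blockIndex _ m ⟨n + m, hM⟩)) = _)] at h
    rw [signSum_odd] at h
    exact h

end
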